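/- For an integer $\ell\ge 1$, $\lambda>0$ and $\underline h=(h_1,\dots,h_\ell)\in\mathbb R^\ell$ let $$Z_{\ell,\underline h}=\sum_{\sigma\in\{-1,1\}^{\ell}}\exp\Big(\sum_{i=1}^\ell\{\lambda\sigma(i)\sigma(i+1)+h_i\sigma(i)\}\Big),\qquad \sigma(\ell+1):=\sigma(1),$$ be the partition function of the one-dimensional periodic Ising chain in an inhomogeneous field, and let $$Z^*_{\ell,\underline h}=Z_{\ell,\underline h}\Big\{\prod_{i=1}^\ell(e^{h_i}+e^{-h_i})\Big\}^{-1},\qquad u_i=\tanh(h_i).$$ For $N:\{1,\dots,\ell\}\to\mathbb N=\{0,1,2,\dots\}$ put $u^N=\prod_i u_i^{N(i)}$, $|N|=\sum_i N(i)$, and $\|N\|=\max\{|N|,R(N)\}$, where $R(N)$ is the number of sites of the smallest interval of the periodic chain (so that $\ell$ and $1$ are consecutive) which contains $\{i:N(i)>0\}$, with $R(0)=0$. Let $d(i,j)=\min\{|i-j|,\ell-|i-j|\}$ be the distance on the periodic chain, and define $b$ by $e^b=\lambda^{-5/12}$. There are $\lambda_0>0$ and a constant $c$, both independent of $\ell$,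 such that for every $\lambda\in(0,\lambda_0)$ and every $\ell\ge1$ there are real coefficients $A_N$ (depending on $\lambda$ and $\ell$ but not on $\underline h$) with the following properties. 1. $\sum_N|A_N|<\infty$, and for every $\underline h\in\mathbb R^\ell$ $$\log Z^*_{\ell,\underline h}=\sum_N A_N\,u^N .$$ 2. For every $i\in\{1,\dots,\ell\}$ and every positive integer $M$, $$\sum_{N:\,N(i)>0,\ \|N\|\ge M}|A_N|\le e^{-bM}.$$ 3. $A_N=0$ whenever $|N|$ is odd. 4. There are real coefficients $\alpha_k$, $k\ge1$ (depending on $\lambda$ and $\ell$), such that for all $u\in\mathbb R^\ell$ $$\sum_{N:\,|N|=2}A_N\,u^N=\sum_{1\le i<j\le\ell}\alpha_{d(i,j)}\,u_iu_j,$$ with $|\alpha_k|\le c\,\lambda^k e^k$ for all $k\ge1$ and, if $\ell\ge3$, $|\alpha_1-\lambda|\le c\,\lambda e^{-2b}$. -/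

import Mathlib

noncomputable section

namespace IsingChain

/-- Partition function of the one-dimensional nearest neighbour Ising model on the periodic chain
of `ℓ` sites (addition in `Fin ℓ` is cyclic, so the site after the last one is the first one), with
coupling `lam` and site dependent magnetic field `h`; the sum is over all `σ ∈ {-1, 1}^ℓ`. -/
def partitionFunction (ℓ : ℕ) [NeZero ℓ] (lam : ℝ) (h : Fin ℓ → ℝ) : ℝ :=
  ∑ σ ∈ Fintype.piFinset (fun _ : Fin ℓ => ({-1, 1} : Finset ℝ)),
    Real.exp (∑ i, (lam * σ i * σ (i + 1) + h i * σ i))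

/-- The partition function divided by that of the free spins in the same field. -/
def reducedPartitionFunction (ℓ : ℕ) [NeZero ℓ] (lam : ℝ) (h : Fin ℓ → ℝ) : ℝ :=
  partitionFunction ℓ lam h * (∏ i, (Real.exp (h i) + Real.exp (-h i)))⁻¹

/-- The monomial `u ^ N = ∏ i, u i ^ N i`. -/
def monomial {ℓ : ℕ} (u : Fin ℓ → ℝ) (N : Fin ℓ → ℕ) : ℝ :=
  ∏ i, u i ^ N i

/-- `|N| = ∑ i, N i`. -/
def degree {ℓ : ℕ} (N : Fin ℓ → ℕ) : ℕ :=
  ∑ i, N i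

/-- The interval of the periodic chain that starts at `a` and consists of the `n` sites
`a, a + 1, …, a + n - 1` (of all sites if `ℓ ≤ n`). -/
def arc {ℓ : ℕ} [NeZero ℓ] (a : Fin ℓ) (n : ℕ) : Finset (Fin ℓ) :=
  Finset.univ.filter fun i => (i - a).val < n

/-- `R(N)`: the number of sites of the smallest interval of the periodic chain which contains
`{i | N i > 0}` (it is `0` for `N = 0`). -/
def arcLength {ℓ : ℕ} [NeZero ℓ] (N : Fin ℓ → ℕ) : ℕ :=
  sInf {r : ℕ | ∃ (a : Fin ℓ) (n : ℕ), (∀ i, 0 < N i → i ∈ arc a n) ∧ (arc a n).card = r}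

/-- `‖N‖ = max {|N|, R(N)}`. -/
def size {ℓ : ℕ} [NeZero ℓ] (N : Fin ℓ → ℕ) : ℕ :=
  max (degree N) (arcLength N)

/-- Distance of two sites on the periodic chain. -/
def ringDist {ℓ : ℕ} [NeZero ℓ] (i j : Fin ℓ) : ℕ :=
  min (j - i).val (i - j).val

end IsingChain

end

noncomputable section

namespace IsingChain

/-! ### Spin sums and the transfer iteration in the variables `t` and `u`. -/

section Transfer

variable {K : Type*} [CommRing K]

/-! With `t = tanh lam`, the reduced partition function is `cosh lam ^ ℓ` times a polynomial `P(t,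
u)`, the normalised spin sum of the product of the factors `1 + u_i σ_i` and `1 + t σ_i σ_{i+1}`
(`reducedPartitionFunction_eq`). Since `P(0, u) = 1`, its logarithm is obtained by integrating the
formal series `P'/P` in `t`, whose coefficients are polynomials in `u`.

Building the ring site by site factorises `P`: adding a site to the open chain multiplies by `1 + t
u m`, where `m` is the magnetization at the end, and closing the ring multiplies by `1 + t C`, where
`C` is the correlation of the two ends. The logarithmic derivative is therefore a sum over sites. In
the weighted `ℓ¹` norm of coefficients each summand is bounded independently of the length
(`endMagnet_bound`, `endCorr_bound`).

Locality: only the last two summands can contain the variable of the last site. Their coefficients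
of order `k` live on an arc of `k + 2` sites and have total norm at most `27 * 16 ^ k`
(`exists_anchored`). Since `P` is invariant under rotation, so is `P'/P`, and the bound holds at
every site (`ringLogDeriv_rotate`, `sum_abs_logDerivCoeff_le`).

Decay and parity: order `t ^ (k + 1)` of the logarithm has only monomials of even degree at most `2
(k + 1)`. Thus a monomial of size at least `M` needs `2 (k + 1) ≥ M`, which gives a factor `(128 t)
^ ⌈M / 2⌉`; the choice of `b` and small `lam` turn this into `exp (-b M)`
(`sum_tsum_expansionTerm_le`, `decay_rate`).

Quadratic part: replacing `u` by `x u` and comparing the order `x ^ 2` of both sides gives the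
couplings in closed form (`quadratic_part`). -/

/-- Iteration of the transfer matrix of the chain in the variables `t` and `u`. -/
def chain (t : K) (u : ℕ → K) (p : K × K) : ℕ → K × K
  | 0 => p
  | n + 1 => ((chain t u p n).1 + t * u (n + 1) * (chain t u p n).2,
      u (n + 1) * (chain t u p n).1 + t * (chain t u p n).2)

/-- The partition function of the periodic chain with `n + 1` sites in the variables `t`, `u`,
in terms of two transfer iterations. -/
def ringChain (t : K) (u : ℕ → K) (n : ℕ) : K :=
  (chain t u (1, u 0) n).1 + t * (chain t u (u 0, 1) n).2

/-- The periodic extension of a field on the ring to the natural numbers. -/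
def periodic {α : Type*} {n : ℕ} (u : Fin (n + 1) → α) (k : ℕ) : α := u (Fin.ofNat (n + 1) k)

theorem periodic_val {α : Type*} {n : ℕ} (u : Fin (n + 1) → α) (i : Fin (n + 1)) :
    periodic u i = u i := by
  simp [periodic]

theorem map_chain {K' : Type*} [CommRing K'] (φ : K →+* K') (t : K) (u : ℕ → K) (p : K × K)
    (n : ℕ) :
    chain (φ t) (fun k => φ (u k)) (φ p.1, φ p.2) n
      = (φ (chain t u p n).1, φ (chain t u p n).2) := by
  induction n with
  | zero => rfl
  | succ n ih => simp [chain, ih]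

theorem map_ringChain {K' : Type*} [CommRing K'] (φ : K →+* K') (t : K) (u : ℕ → K) (n : ℕ) :
    φ (ringChain t u n) = ringChain (φ t) (fun k => φ (u k)) n := by
  have h1 := map_chain φ t u (1, u 0) n
  have h2 := map_chain φ t u (u 0, 1) n
  simp only [map_one] at h1 h2
  simp [ringChain, h1, h2]

/-- The value of a spin in `K`. -/
def spin (s : ℤˣ) : K := ((s : ℤ) : K)

@[simp] theorem spin_one : (spin 1 : K) = 1 := by simp [spin]

@[simp] theorem spin_neg_one : (spin (-1) : K) = -1 := by simp [spin]

theorem sum_units (f : ℤˣ → K) : ∑ s, f s = f 1 + f (-1) := by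
  rw [UnitsInt.univ, Finset.sum_pair (by decide)]

/-- The weight of a spin configuration on an open chain. -/
def openWeight (t : K) (u : ℕ → K) (n : ℕ) (σ : Fin (n + 1) → ℤˣ) : K :=
  (∏ i, (1 + spin (σ i) * u i)) * ∏ i : Fin n, (1 + t * spin (σ i.castSucc) * spin (σ i.succ))

theorem openWeight_snoc (t : K) (u : ℕ → K) (n : ℕ) (σ : Fin (n + 1) → ℤˣ) (s : ℤˣ) :
    openWeight t u (n + 1) (Fin.snoc σ s) = openWeight t u n σ *
      ((1 + spin s * u (n + 1)) * (1 + t * spin (σ (Fin.last n)) * spin s)) := by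
  unfold openWeight
  rw [Fin.prod_univ_castSucc, Fin.prod_univ_castSucc (fun i : Fin (n + 1) =>
    1 + t * spin (Fin.snoc (α := fun _ => ℤˣ) σ s i.castSucc)
      * spin (Fin.snoc (α := fun _ => ℤˣ) σ s i.succ))]
  simp only [Fin.snoc_castSucc, Fin.snoc_last, ← Fin.castSucc_succ, Fin.succ_last, Fin.val_castSucc,
    Fin.val_last]
  ring

theorem sum_snoc (n : ℕ) (F : (Fin (n + 2) → ℤˣ) → K) :
    ∑ σ, F σ = ∑ σ : Fin (n + 1) → ℤˣ,
      (F (Fin.snoc (α := fun _ => ℤˣ) σ 1) + F (Fin.snoc (α := fun _ => ℤˣ) σ (-1))) := by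
  rw [← (Fin.snocEquiv (fun _ : Fin (n + 2) => ℤˣ)).sum_comp, Fintype.sum_prod_type_right]
  refine Finset.sum_congr rfl fun σ _ => ?_
  rw [sum_units]
  rfl

/-- The sums weighted by `1`, the last spin, the first spin and their product close under adding a
site. The start vector `(1, u 0)` carries the plain weight, `(u 0, 1)` the weight with an extra
first spin. -/
theorem sum_openWeight (t : K) (u : ℕ → K) (n : ℕ) :
    ∑ σ, openWeight t u n σ = 2 ^ (n + 1) * (chain t u (1, u 0) n).1 ∧
    ∑ σ, openWeight t u n σ * spin (σ (Fin.last n)) = 2 ^ (n + 1) * (chain t u (1, u 0) n).2 ∧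
    ∑ σ, openWeight t u n σ * spin (σ 0) = 2 ^ (n + 1) * (chain t u (u 0, 1) n).1 ∧
    ∑ σ, openWeight t u n σ * (spin (σ 0) * spin (σ (Fin.last n)))
      = 2 ^ (n + 1) * (chain t u (u 0, 1) n).2 := by
  induction n with
  | zero =>
    have h (F : (Fin 1 → ℤˣ) → K) : ∑ σ, F σ = F (fun _ => 1) + F (fun _ => -1) := by
      rw [← (Equiv.funUnique (Fin 1) ℤˣ).symm.sum_comp, sum_units]
      rfl
    simp only [h, openWeight, chain]
    refine ⟨?_, ?_, ?_, ?_⟩ <;> simp <;> ring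
  | succ n ih =>
    obtain ⟨h1, h2, h3, h4⟩ := ih
    have h0 (σ : Fin (n + 1) → ℤˣ) (s : ℤˣ) :
        Fin.snoc (α := fun _ => ℤˣ) σ s 0 = σ 0 := by
      exact Fin.snoc_castSucc (α := fun _ => ℤˣ) s σ 0
    simp only [sum_snoc, openWeight_snoc, Fin.snoc_last, h0, spin_one, spin_neg_one, chain]
    refine ⟨?_, ?_, ?_, ?_⟩
    · trans 2 * (∑ σ, openWeight t u n σ)
        + 2 * t * u (n + 1) * ∑ σ, openWeight t u n σ * spin (σ (Fin.last n))
      · simp only [Finset.mul_sum, ← Finset.sum_add_distrib]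
        exact Finset.sum_congr rfl fun σ _ => by ring
      · rw [h1, h2]; ring
    · trans 2 * u (n + 1) * (∑ σ, openWeight t u n σ)
        + 2 * t * ∑ σ, openWeight t u n σ * spin (σ (Fin.last n))
      · simp only [Finset.mul_sum, ← Finset.sum_add_distrib]
        exact Finset.sum_congr rfl fun σ _ => by ring
      · rw [h1, h2]; ring
    · trans 2 * (∑ σ, openWeight t u n σ * spin (σ 0))
        + 2 * t * u (n + 1) * ∑ σ, openWeight t u n σ * (spin (σ 0) * spin (σ (Fin.last n)))
      · simp only [Finset.mul_sum, ← Finset.sum_add_distrib]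
        exact Finset.sum_congr rfl fun σ _ => by ring
      · rw [h3, h4]; ring
    · trans 2 * u (n + 1) * (∑ σ, openWeight t u n σ * spin (σ 0))
        + 2 * t * ∑ σ, openWeight t u n σ * (spin (σ 0) * spin (σ (Fin.last n)))
      · simp only [Finset.mul_sum, ← Finset.sum_add_distrib]
        exact Finset.sum_congr rfl fun σ _ => by ring
      · rw [h3, h4]; ring

/-- The weight of a spin configuration on the periodic chain. -/
def ringWeight (t : K) {n : ℕ} (u : Fin (n + 1) → K) (σ : Fin (n + 1) → ℤˣ) : K :=
  ∏ i, ((1 + spin (σ i) * u i) * (1 + t * spin (σ i) * spin (σ (i + 1))))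

theorem sum_ringWeight (t : K) {n : ℕ} (u : Fin (n + 1) → K) :
    ∑ σ, ringWeight t u σ = 2 ^ (n + 1) * ringChain t (periodic u) n := by
  obtain ⟨h1, -, -, h4⟩ := sum_openWeight t (periodic u) n
  -- The bond from the last site to site `0` contributes `1 + t σ_last σ_0` to the open weight.
  trans (∑ σ, openWeight t (periodic u) n σ)
    + t * ∑ σ, openWeight t (periodic u) n σ * (spin (σ 0) * spin (σ (Fin.last n)))
  · simp only [Finset.mul_sum, ← Finset.sum_add_distrib]
    refine Finset.sum_congr rfl fun σ _ => ?_
    rw [ringWeight, Finset.prod_mul_distrib, openWeight,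
      Fin.prod_univ_castSucc (fun i => 1 + t * spin (σ i) * spin (σ (i + 1)))]
    simp only [Fin.coeSucc_eq_succ, Fin.last_add_one, periodic_val]
    ring
  · rw [h1, h4, ringChain]; ring

theorem sum_ringWeight_rotate (t : K) {n : ℕ} (u : Fin (n + 1) → K) (a : Fin (n + 1)) :
    ∑ σ, ringWeight t (fun i => u (i + a)) σ = ∑ σ, ringWeight t u σ := by
  refine Fintype.sum_equiv ((Equiv.addRight (-a)).arrowCongr (Equiv.refl _)).symm _ _ fun σ => ?_
  unfold ringWeight
  refine Fintype.prod_equiv (Equiv.addRight a) _ _ fun i => ?_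
  simp [Equiv.arrowCongr, add_right_comm]

/-- The transfer iteration singles out site `0`; the symmetry is visible only in the spin sum, from
which the power of `2` is cancelled. -/
theorem ringChain_rotate [IsDomain K] (h2 : (2 : K) ≠ 0) (t : K) {n : ℕ} (u : Fin (n + 1) → K)
    (a : Fin (n + 1)) :
    ringChain t (periodic fun i => u (i + a)) n = ringChain t (periodic u) n := by
  have h := sum_ringWeight_rotate t u a
  rw [sum_ringWeight, sum_ringWeight] at h
  exact mul_left_cancel₀ (pow_ne_zero _ h2) h

end Transfer

theorem partitionFunction_eq_sum {ℓ : ℕ} [NeZero ℓ] (lam : ℝ) (h : Fin ℓ → ℝ) :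
    partitionFunction ℓ lam h = ∑ σ : Fin ℓ → ℤˣ,
      Real.exp (∑ i, (lam * spin (σ i) * spin (σ (i + 1)) + h i * spin (σ i))) := by
  unfold partitionFunction
  symm
  refine Finset.sum_bij (fun σ _ i => spin (σ i)) ?_ ?_ ?_ ?_
  · intro σ _
    refine Fintype.mem_piFinset.2 fun i => ?_
    rcases Int.units_eq_one_or (σ i) with h | h <;> simp [h]
  · intro σ _ τ _ hst
    funext i
    have := congrFun hst i
    simpa [spin, Units.ext_iff] using this
  · intro σ hσ
    rw [Fintype.mem_piFinset] at hσ
    refine ⟨fun i => if σ i = 1 then 1 else -1, Finset.mem_univ _, ?_⟩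
    funext i
    have := hσ i
    simp only [Finset.mem_insert, Finset.mem_singleton] at this
    rcases this with h1 | h1 <;> norm_num [h1]
  · intro σ _
    rfl

theorem exp_mul_spin (x : ℝ) (s : ℤˣ) :
    Real.exp (x * spin s) = Real.cosh x * (1 + Real.tanh x * spin s) := by
  have hc := (Real.cosh_pos x).ne'
  rcases Int.units_eq_one_or s with h | h <;> subst h
  · rw [Real.tanh_eq_sinh_div_cosh]
    field_simp
    simp [Real.cosh_add_sinh]
  · rw [Real.tanh_eq_sinh_div_cosh]
    field_simp
    simp only [spin_neg_one, mul_neg, mul_one]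
    rw [← Real.cosh_sub_sinh]; ring

/-- High-temperature form: for a sign `s`, `exp (x s) = cosh x (1 + s tanh x)`, and the factors `2
cosh (h i)` cancel against the free normalisation. -/
theorem reducedPartitionFunction_eq {n : ℕ} (lam : ℝ) (h : Fin (n + 1) → ℝ) :
    reducedPartitionFunction (n + 1) lam h = Real.cosh lam ^ (n + 1) *
      ringChain (Real.tanh lam) (periodic fun i => Real.tanh (h i)) n := by
  have hspin (s s' : ℤˣ) : (spin s * spin s' : ℝ) = spin (s * s') := by simp [spin]
  have hterm (σ : Fin (n + 1) → ℤˣ) :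
      Real.exp (∑ i, (lam * spin (σ i) * spin (σ (i + 1)) + h i * spin (σ i)))
        = Real.cosh lam ^ (n + 1) * (∏ i, Real.cosh (h i)) *
          ringWeight (Real.tanh lam) (fun i => Real.tanh (h i)) σ := by
    have hconst : Real.cosh lam ^ (n + 1) = ∏ _i : Fin (n + 1), Real.cosh lam := by simp
    rw [Real.exp_sum, hconst, ringWeight, ← Finset.prod_mul_distrib, ← Finset.prod_mul_distrib]
    refine Finset.prod_congr rfl fun i _ => ?_
    rw [Real.exp_add, mul_assoc, hspin, exp_mul_spin, exp_mul_spin, ← hspin]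
    ring
  have hden : ∏ i, (Real.exp (h i) + Real.exp (-h i)) = 2 ^ (n + 1) * ∏ i, Real.cosh (h i) := by
    have hconst : (2 : ℝ) ^ (n + 1) = ∏ _i : Fin (n + 1), (2 : ℝ) := by simp
    rw [hconst, ← Finset.prod_mul_distrib]
    refine Finset.prod_congr rfl fun i _ => ?_
    rw [Real.cosh_eq]; ring
  rw [reducedPartitionFunction, partitionFunction_eq_sum, hden]
  simp only [hterm]
  rw [← Finset.mul_sum, sum_ringWeight]
  have : ∏ i, Real.cosh (h i) ≠ 0 := Finset.prod_ne_zero_iff.2 fun i _ => (Real.cosh_pos _).ne'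
  field_simp

end IsingChain

namespace IsingChain

open PowerSeries

/-! ### Weighted `ℓ¹` norms of power series with polynomial coefficients. -/

section Norm

variable {σ : Type*}

/-- The sum of the absolute values of the coefficients of a polynomial. -/
def coeffNorm (p : MvPolynomial σ ℝ) : ℝ := ∑ N ∈ p.support, |p.coeff N|

theorem coeffNorm_eq_sum {p : MvPolynomial σ ℝ} {S : Finset (σ →₀ ℕ)} (h : p.support ⊆ S) :
    coeffNorm p = ∑ N ∈ S, |p.coeff N| :=
  Finset.sum_subset h fun N _ hN => by simpa using hN

theorem coeffNorm_nonneg (p : MvPolynomial σ ℝ) : 0 ≤ coeffNorm p :=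
  Finset.sum_nonneg fun _ _ => abs_nonneg _

theorem sum_abs_coeff_le (p : MvPolynomial σ ℝ) (S : Finset (σ →₀ ℕ)) :
    ∑ N ∈ S, |p.coeff N| ≤ coeffNorm p := by
  classical
  rw [coeffNorm_eq_sum (Finset.subset_union_left (s₂ := S))]
  exact Finset.sum_le_sum_of_subset_of_nonneg Finset.subset_union_right
    fun _ _ _ => abs_nonneg _

@[simp] theorem coeffNorm_zero : coeffNorm (0 : MvPolynomial σ ℝ) = 0 := by simp [coeffNorm]

theorem coeffNorm_neg (p : MvPolynomial σ ℝ) : coeffNorm (-p) = coeffNorm p := by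
  simp [coeffNorm]

theorem coeffNorm_add_le (p q : MvPolynomial σ ℝ) :
    coeffNorm (p + q) ≤ coeffNorm p + coeffNorm q := by
  classical
  rw [coeffNorm_eq_sum (MvPolynomial.support_add (p := p) (q := q)),
    coeffNorm_eq_sum (Finset.subset_union_left (s₂ := q.support)),
    coeffNorm_eq_sum (Finset.subset_union_right (s₁ := p.support)), ← Finset.sum_add_distrib]
  exact Finset.sum_le_sum fun N _ => by
    rw [MvPolynomial.coeff_add]; exact abs_add_le _ _

theorem coeffNorm_sum_le {ι : Type*} (s : Finset ι) (f : ι → MvPolynomial σ ℝ) :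
    coeffNorm (∑ i ∈ s, f i) ≤ ∑ i ∈ s, coeffNorm (f i) :=
  Finset.le_sum_of_subadditive coeffNorm coeffNorm_zero.le coeffNorm_add_le s f

theorem coeffNorm_monomial (N : σ →₀ ℕ) (a : ℝ) :
    coeffNorm (MvPolynomial.monomial N a) = |a| := by
  classical
  rw [coeffNorm_eq_sum MvPolynomial.support_monomial_subset]
  simp

theorem coeffNorm_X (i : σ) : coeffNorm (MvPolynomial.X i : MvPolynomial σ ℝ) = 1 :=
  (coeffNorm_monomial (Finsupp.single i 1) 1).trans abs_one

theorem coeffNorm_one : coeffNorm (1 : MvPolynomial σ ℝ) = 1 := by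
  simpa using coeffNorm_monomial (0 : σ →₀ ℕ) 1

theorem coeffNorm_mul_le (p q : MvPolynomial σ ℝ) :
    coeffNorm (p * q) ≤ coeffNorm p * coeffNorm q := by
  rw [MvPolynomial.mul_def]
  refine (coeffNorm_sum_le _ _).trans ?_
  rw [coeffNorm, Finset.sum_mul]
  refine Finset.sum_le_sum fun M _ => (coeffNorm_sum_le _ _).trans ?_
  rw [coeffNorm, Finset.mul_sum]
  refine Finset.sum_le_sum fun N _ => ?_
  rw [coeffNorm_monomial, abs_mul]
  rfl

theorem abs_eval_le [Fintype σ] (p : MvPolynomial σ ℝ) {v : σ → ℝ} (hv : ∀ i, |v i| ≤ 1) :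
    |MvPolynomial.eval v p| ≤ coeffNorm p := by
  rw [MvPolynomial.eval_eq']
  refine (Finset.abs_sum_le_sum_abs _ _).trans (Finset.sum_le_sum fun N _ => ?_)
  rw [abs_mul, Finset.abs_prod]
  refine mul_le_of_le_one_right (abs_nonneg _) (Finset.prod_le_one (fun _ _ => abs_nonneg _) ?_)
  intro i _
  rw [abs_pow]
  exact pow_le_one₀ (abs_nonneg _) (hv i)

/-- The norm of a power series with radius `ρ` and coefficients in the normed ring of
polynomials is at most `B`. -/
def SeriesBound (ρ B : ℝ) (F : (MvPolynomial σ ℝ)⟦X⟧) : Prop :=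
  ∀ n, ∑ k ∈ Finset.range n, coeffNorm (coeff k F) * ρ ^ k ≤ B

variable {ρ B B' : ℝ} {F G H : (MvPolynomial σ ℝ)⟦X⟧}

theorem SeriesBound.nonneg (h : SeriesBound ρ B F) : 0 ≤ B := by simpa using h 0

theorem SeriesBound.mono (h : SeriesBound ρ B F) (hB : B ≤ B') : SeriesBound ρ B' F :=
  fun n => (h n).trans hB

theorem SeriesBound.coeffNorm_coeff_le (h : SeriesBound ρ B F) (hρ : 0 ≤ ρ) (k : ℕ) :
    coeffNorm (coeff k F) * ρ ^ k ≤ B := by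
  refine le_trans ?_ (h (k + 1))
  exact Finset.single_le_sum (f := fun k => coeffNorm (coeff k F) * ρ ^ k)
    (fun i _ => mul_nonneg (coeffNorm_nonneg _) (pow_nonneg hρ _)) (by simp)

theorem SeriesBound.add (hρ : 0 ≤ ρ) (hF : SeriesBound ρ B F) (hG : SeriesBound ρ B' G) :
    SeriesBound ρ (B + B') (F + G) := fun n => by
  refine le_trans ?_ (add_le_add (hF n) (hG n))
  rw [← Finset.sum_add_distrib]
  refine Finset.sum_le_sum fun k _ => ?_
  rw [map_add, ← add_mul]
  exact mul_le_mul_of_nonneg_right (coeffNorm_add_le _ _) (pow_nonneg hρ _)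

theorem SeriesBound.neg (hF : SeriesBound ρ B F) : SeriesBound ρ B (-F) := fun n => by
  simpa [coeffNorm_neg] using hF n

theorem SeriesBound.sub (hρ : 0 ≤ ρ) (hF : SeriesBound ρ B F) (hG : SeriesBound ρ B' G) :
    SeriesBound ρ (B + B') (F - G) := by
  rw [sub_eq_add_neg]; exact hF.add hρ hG.neg

theorem SeriesBound.C (p : MvPolynomial σ ℝ) : SeriesBound ρ (coeffNorm p) (C p) := fun n => by
  cases n with
  | zero => simpa using coeffNorm_nonneg p
  | succ n => simp [Finset.sum_range_succ', coeff_C]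

theorem SeriesBound.one : SeriesBound ρ 1 (1 : (MvPolynomial σ ℝ)⟦X⟧) := by
  simpa [coeffNorm_one] using SeriesBound.C (ρ := ρ) (1 : MvPolynomial σ ℝ)

theorem SeriesBound.zero : SeriesBound ρ 0 (0 : (MvPolynomial σ ℝ)⟦X⟧) := fun n => by simp

theorem sum_range_X_mul (F : (MvPolynomial σ ℝ)⟦X⟧) (n : ℕ) :
    ∑ k ∈ Finset.range (n + 1), coeffNorm (coeff k (X * F)) * ρ ^ k
      = ρ * ∑ k ∈ Finset.range n, coeffNorm (coeff k F) * ρ ^ k := by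
  rw [Finset.sum_range_succ', Finset.mul_sum]
  simp only [coeff_succ_X_mul, coeff_zero_X_mul, coeffNorm_zero, zero_mul, add_zero]
  exact Finset.sum_congr rfl fun k _ => by ring

theorem SeriesBound.X_mul (hρ : 0 ≤ ρ) (hF : SeriesBound ρ B F) :
    SeriesBound ρ (ρ * B) (X * F) := fun n => by
  cases n with
  | zero => simpa using mul_nonneg hρ hF.nonneg
  | succ n => rw [sum_range_X_mul]; exact mul_le_mul_of_nonneg_left (hF n) hρ

theorem sum_range_mul_le (hρ : 0 ≤ ρ) (F G : (MvPolynomial σ ℝ)⟦X⟧) (n : ℕ) :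
    ∑ k ∈ Finset.range n, coeffNorm (coeff k (F * G)) * ρ ^ k
      ≤ (∑ k ∈ Finset.range n, coeffNorm (coeff k F) * ρ ^ k)
        * ∑ k ∈ Finset.range n, coeffNorm (coeff k G) * ρ ^ k := by
  set a : ℕ → ℝ := fun k => coeffNorm (coeff k F) * ρ ^ k
  set b : ℕ → ℝ := fun k => coeffNorm (coeff k G) * ρ ^ k
  have ha (k) : 0 ≤ a k := mul_nonneg (coeffNorm_nonneg _) (pow_nonneg hρ _)
  have hb (k) : 0 ≤ b k := mul_nonneg (coeffNorm_nonneg _) (pow_nonneg hρ _)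
  have h1 : ∑ k ∈ Finset.range n, coeffNorm (coeff k (F * G)) * ρ ^ k
      ≤ ∑ k ∈ Finset.range n, ∑ p ∈ Finset.HasAntidiagonal.antidiagonal k, a p.1 * b p.2 := by
    refine Finset.sum_le_sum fun k _ => ?_
    rw [coeff_mul]
    refine (mul_le_mul_of_nonneg_right (coeffNorm_sum_le _ _) (pow_nonneg hρ _)).trans ?_
    rw [Finset.sum_mul]
    refine Finset.sum_le_sum fun p hp => ?_
    rw [← Finset.HasAntidiagonal.mem_antidiagonal.1 hp, pow_add]
    refine (mul_le_mul_of_nonneg_right (coeffNorm_mul_le _ _) (by positivity)).trans_eq ?_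
    simp only [a, b]; ring
  refine h1.trans ?_
  rw [Finset.sum_sigma', Finset.sum_mul_sum, ← Finset.sum_product']
  have h2 : Set.InjOn (fun x : (_ : ℕ) × ℕ × ℕ => x.2)
      ((Finset.range n).sigma fun k => Finset.HasAntidiagonal.antidiagonal k) := by
    rintro ⟨k, p⟩ hk ⟨l, q⟩ hl h
    simp only [Finset.coe_sigma, Set.mem_sigma_iff, Finset.mem_coe,
      Finset.HasAntidiagonal.mem_antidiagonal] at hk hl
    obtain rfl : p = q := h
    obtain rfl : k = l := hk.2.symm.trans hl.2
    rfl
  rw [← Finset.sum_image (f := fun p : ℕ × ℕ => a p.1 * b p.2) h2]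
  refine Finset.sum_le_sum_of_subset_of_nonneg ?_ fun p _ _ => mul_nonneg (ha _) (hb _)
  intro p hp
  simp only [Finset.mem_image, Finset.mem_sigma, Finset.mem_range, Finset.HasAntidiagonal.mem_antidiagonal] at hp
  obtain ⟨⟨k, q⟩, ⟨hk, hq⟩, rfl⟩ := hp
  simp only [Finset.mem_product, Finset.mem_range]
  simp only at hk hq
  omega

theorem SeriesBound.mul (hρ : 0 ≤ ρ) (hF : SeriesBound ρ B F) (hG : SeriesBound ρ B' G) :
    SeriesBound ρ (B * B') (F * G) := fun n => by
  refine (sum_range_mul_le hρ F G n).trans (mul_le_mul (hF n) (hG n) ?_ hF.nonneg)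
  exact Finset.sum_nonneg fun _ _ => mul_nonneg (coeffNorm_nonneg _) (pow_nonneg hρ _)

/-- The inverse of `1 + X * H`. -/
def geomInv {R : Type*} [CommRing R] (H : R⟦X⟧) : R⟦X⟧ := invOfUnit (1 + X * H) 1

theorem mul_geomInv {R : Type*} [CommRing R] (H : R⟦X⟧) : (1 + X * H) * geomInv H = 1 :=
  mul_invOfUnit _ _ (by simp)

theorem geomInv_eq {R : Type*} [CommRing R] (H : R⟦X⟧) :
    geomInv H = 1 - X * (H * geomInv H) := by
  linear_combination mul_geomInv H

/-- In `V = 1 - X H V` the factor `X` makes the partial sum of length `n + 1` depend only on the one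
of length `n`, so any `B'` that the bound `1 + ρ B B'` does not exceed is preserved by induction. -/
theorem SeriesBound.geomInv (hρ : 0 ≤ ρ) (hH : SeriesBound ρ B H) (hB : 0 ≤ B')
    (h : 1 + ρ * (B * B') ≤ B') : SeriesBound ρ B' (geomInv H) := fun n => by
  induction n with
  | zero => simpa using hB
  | succ n ih =>
    refine le_trans ?_ h
    have h1 : ∑ k ∈ Finset.range (n + 1), coeffNorm (coeff k (IsingChain.geomInv H)) * ρ ^ k
        ≤ ∑ k ∈ Finset.range (n + 1), coeffNorm (coeff k (1 : (MvPolynomial σ ℝ)⟦X⟧)) * ρ ^ k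
        + ∑ k ∈ Finset.range (n + 1),
          coeffNorm (coeff k (X * (H * IsingChain.geomInv H))) * ρ ^ k := by
      rw [← Finset.sum_add_distrib]
      refine Finset.sum_le_sum fun k _ => ?_
      rw [← add_mul]
      refine mul_le_mul_of_nonneg_right ?_ (pow_nonneg hρ _)
      conv_lhs => rw [geomInv_eq, sub_eq_add_neg, map_add, map_neg]
      refine (coeffNorm_add_le _ _).trans_eq ?_
      rw [coeffNorm_neg]
    refine h1.trans (add_le_add (SeriesBound.one _) ?_)
    rw [sum_range_X_mul]
    refine mul_le_mul_of_nonneg_left ((sum_range_mul_le hρ _ _ n).trans ?_) hρ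
    refine mul_le_mul (hH n) ih ?_ hH.nonneg
    exact Finset.sum_nonneg fun _ _ => mul_nonneg (coeffNorm_nonneg _) (pow_nonneg hρ _)

/-- Halving the radius pays for the factor `k + 1 ≤ 2 ^ k` of differentiation. -/
theorem SeriesBound.derivative_X_mul (hρ : 0 ≤ ρ) (hF : SeriesBound ρ B F) :
    SeriesBound (ρ / 2) B (derivative _ (X * F)) := fun n => by
  refine le_trans (Finset.sum_le_sum fun k _ => ?_) (hF n)
  rw [coeff_derivative, coeff_succ_X_mul, div_pow]
  have h1 : coeffNorm (coeff k F * ((k : MvPolynomial σ ℝ) + 1))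
      ≤ coeffNorm (coeff k F) * 2 ^ k := by
    refine (coeffNorm_mul_le _ _).trans (mul_le_mul_of_nonneg_left ?_ (coeffNorm_nonneg _))
    have : ((k : MvPolynomial σ ℝ) + 1) = MvPolynomial.monomial 0 ((k : ℝ) + 1) := by
      rw [MvPolynomial.monomial_zero']; simp
    rw [this, coeffNorm_monomial, abs_of_nonneg (by positivity)]
    exact_mod_cast Nat.lt_two_pow_self (n := k)
  calc _ ≤ coeffNorm (coeff k F) * 2 ^ k * (ρ ^ k / 2 ^ k) :=
        mul_le_mul_of_nonneg_right h1 (by positivity)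
    _ = _ := by field_simp

theorem SeriesBound.mono_radius {ρ' : ℝ} (hρ : 0 ≤ ρ') (h : ρ' ≤ ρ) (hF : SeriesBound ρ B F) :
    SeriesBound ρ' B F := fun n =>
  (Finset.sum_le_sum fun _ _ => mul_le_mul_of_nonneg_left (pow_le_pow_left₀ hρ h _)
    (coeffNorm_nonneg _)).trans (hF n)

end Norm

/-! ### Tracking which monomials occur at each order in `t`. -/

section Support

variable {σ : Type*}

/-- The monomials in the `k`-th coefficient of `F` belong to `S k`. -/
def SeriesSupport (S : ℕ → Set (σ →₀ ℕ)) (F : (MvPolynomial σ ℝ)⟦X⟧) : Prop :=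
  ∀ k N, (coeff k F).coeff N ≠ 0 → N ∈ S k

variable {S S' T : ℕ → Set (σ →₀ ℕ)} {F G H : (MvPolynomial σ ℝ)⟦X⟧}

theorem SeriesSupport.mono (hF : SeriesSupport S F) (h : ∀ k, S k ⊆ T k) : SeriesSupport T F :=
  fun k N hN => h k (hF k N hN)

theorem SeriesSupport.add (hF : SeriesSupport S F) (hG : SeriesSupport S G) :
    SeriesSupport S (F + G) := fun k N hN => by
  rw [map_add, MvPolynomial.coeff_add] at hN
  by_cases h : (coeff k F).coeff N = 0
  · rw [h, zero_add] at hN; exact hG k N hN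
  · exact hF k N h

theorem SeriesSupport.neg (hF : SeriesSupport S F) : SeriesSupport S (-F) := fun k N hN =>
  hF k N (by simpa using hN)

theorem SeriesSupport.sub (hF : SeriesSupport S F) (hG : SeriesSupport S G) :
    SeriesSupport S (F - G) := by
  rw [sub_eq_add_neg]; exact hF.add hG.neg

theorem exists_coeff_ne_zero_of_mul {p q : MvPolynomial σ ℝ} {N : σ →₀ ℕ}
    (h : (p * q).coeff N ≠ 0) : ∃ M M', p.coeff M ≠ 0 ∧ q.coeff M' ≠ 0 ∧ M + M' = N := by
  classical
  rw [MvPolynomial.coeff_mul] at h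
  obtain ⟨⟨M, M'⟩, hM, h⟩ := Finset.exists_ne_zero_of_sum_ne_zero h
  exact ⟨M, M', left_ne_zero_of_mul h, right_ne_zero_of_mul h, Finset.HasAntidiagonal.mem_antidiagonal.1 hM⟩

theorem exists_coeff_mul_ne_zero {k : ℕ} {N : σ →₀ ℕ} (h : (coeff k (F * G)).coeff N ≠ 0) :
    ∃ i j M M', i + j = k ∧ M + M' = N ∧ (coeff i F).coeff M ≠ 0 ∧ (coeff j G).coeff M' ≠ 0 := by
  rw [coeff_mul, MvPolynomial.coeff_sum] at h
  obtain ⟨⟨i, j⟩, hij, h⟩ := Finset.exists_ne_zero_of_sum_ne_zero h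
  obtain ⟨M, M', h1, h2, h3⟩ := exists_coeff_ne_zero_of_mul h
  exact ⟨i, j, M, M', Finset.HasAntidiagonal.mem_antidiagonal.1 hij, h3, h1, h2⟩

theorem SeriesSupport.mul (hF : SeriesSupport S F) (hG : SeriesSupport S' G)
    (h : ∀ i j, ∀ M ∈ S i, ∀ M' ∈ S' j, M + M' ∈ T (i + j)) : SeriesSupport T (F * G) :=
  fun k N hN => by
  obtain ⟨i, j, M, M', rfl, rfl, h1, h2⟩ := exists_coeff_mul_ne_zero hN
  exact h i j M (hF i M h1) M' (hG j M' h2)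

theorem SeriesSupport.X_mul (hF : SeriesSupport S F) (h : ∀ k, S k ⊆ T (k + 1)) :
    SeriesSupport T (X * F) := fun k N hN => by
  cases k with
  | zero => simp at hN
  | succ k => rw [coeff_succ_X_mul] at hN; exact h k (hF k N hN)

theorem SeriesSupport.X_pow_mul (hF : SeriesSupport S F) (m : ℕ) (h : ∀ k, S k ⊆ T (k + m)) :
    SeriesSupport T (X ^ m * F) := by
  intro k N hN
  rw [coeff_X_pow_mul'] at hN
  split_ifs at hN with hm
  · have := h _ (hF _ N hN)
    rwa [Nat.sub_add_cancel hm] at this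
  · simp at hN

theorem SeriesSupport.derivative (hF : SeriesSupport S F) :
    SeriesSupport (fun k => S (k + 1)) (derivative _ F) := fun k N hN => by
  rw [coeff_derivative] at hN
  refine hF _ N fun h0 => hN ?_
  have : ((k : MvPolynomial σ ℝ) + 1) = MvPolynomial.C ((k : ℝ) + 1) := by simp
  rw [this, mul_comm, MvPolynomial.coeff_C_mul, h0, mul_zero]

theorem SeriesSupport.one (h0 : (0 : σ →₀ ℕ) ∈ S 0) :
    SeriesSupport S (1 : (MvPolynomial σ ℝ)⟦X⟧) := fun k N hN => by
  classical
  rw [coeff_one] at hN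
  split_ifs at hN with hk
  · subst hk
    rw [MvPolynomial.coeff_one] at hN
    split_ifs at hN with hN0
    · exact hN0 ▸ h0
    · simp at hN
  · simp at hN

theorem SeriesSupport.C_X {i : σ} (h : Finsupp.single i 1 ∈ S 0) :
    SeriesSupport S (C (MvPolynomial.X i : MvPolynomial σ ℝ)) := fun k N hN => by
  classical
  rw [coeff_C] at hN
  split_ifs at hN with hk
  · subst hk
    rw [MvPolynomial.coeff_X] at hN
    split_ifs at hN with hN0
    · exact hN0 ▸ h
    · simp at hN
  · simp at hN

/-- The hypothesis concerns `X * H`, not `H`, so that supports are indexed by the true order in `t`;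
the recursion for the inverse then runs by strong induction. -/
theorem SeriesSupport.geomInv (h0 : 0 ∈ S 0) (hS : ∀ i j, ∀ M ∈ S i, ∀ M' ∈ S j, M + M' ∈ S (i + j))
    (hH : SeriesSupport S (X * H)) : SeriesSupport S (geomInv H) := fun k => by
  induction k using Nat.strong_induction_on with
  | _ k ih =>
    intro N hN
    rw [geomInv_eq] at hN
    cases k with
    | zero =>
      refine SeriesSupport.one h0 0 N ?_
      simpa using hN
    | succ k =>
      rw [map_sub, coeff_succ_X_mul, coeff_one, if_neg (Nat.succ_ne_zero k), zero_sub,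
        MvPolynomial.coeff_neg, neg_ne_zero] at hN
      obtain ⟨i, j, M, M', hij, rfl, h1, h2⟩ := exists_coeff_mul_ne_zero hN
      have h3 : M ∈ S (i + 1) := hH (i + 1) M (by rwa [coeff_succ_X_mul])
      have h4 : M' ∈ S j := ih j (by omega) M' h2
      have := hS _ _ M h3 M' h4
      rwa [show i + 1 + j = k + 1 by omega] at this

end Support

end IsingChain

namespace IsingChain

open PowerSeries

/-! ### Factorisation of the partition function and its logarithmic derivative. -/

section Series

variable {R : Type*} [CommRing R]

/-- The magnetization at the last site of the open chain. -/
def endMagnet (w : ℕ → R⟦X⟧) : ℕ → R⟦X⟧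
  | 0 => w 0
  | k + 1 => (w (k + 1) + X * endMagnet w k) * geomInv (w (k + 1) * endMagnet w k)

/-- The ratio of the partition functions of the open chains with `k + 1` and `k + 2` sites. -/
def stepInv (w : ℕ → R⟦X⟧) (k : ℕ) : R⟦X⟧ := geomInv (w (k + 1) * endMagnet w k)

/-- The truncated correlation of the first and the last site of the open chain. -/
def endTrunc (w : ℕ → R⟦X⟧) : ℕ → R⟦X⟧
  | 0 => 1 - w 0 * w 0
  | k + 1 => X * (endTrunc w k * ((1 - w (k + 1) * w (k + 1)) * (stepInv w k * stepInv w k)))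

/-- The magnetization at the first site of the open chain. -/
def firstMagnet (w : ℕ → R⟦X⟧) : ℕ → R⟦X⟧
  | 0 => w 0
  | k + 1 => firstMagnet w k + X * (w (k + 1) * stepInv w k * endTrunc w k)

/-- The correlation of the first and the last site of the open chain. -/
def endCorr (w : ℕ → R⟦X⟧) (k : ℕ) : R⟦X⟧ := endTrunc w k + firstMagnet w k * endMagnet w k

/-- The logarithmic derivative of the partition function of the open chain. -/
def openLogDeriv (w : ℕ → R⟦X⟧) : ℕ → R⟦X⟧
  | 0 => 0
  | k + 1 => openLogDeriv w k + derivative R (X * (w (k + 1) * endMagnet w k)) * stepInv w k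

/-- The logarithmic derivative of the partition function of the periodic chain. -/
def ringLogDeriv (w : ℕ → R⟦X⟧) (k : ℕ) : R⟦X⟧ :=
  openLogDeriv w k + derivative R (X * endCorr w k) * geomInv (endCorr w k)

variable (w : ℕ → R⟦X⟧)

theorem mul_stepInv (k : ℕ) : (1 + X * (w (k + 1) * endMagnet w k)) * stepInv w k = 1 :=
  mul_geomInv _

/-- All four moments are the open partition function times an expectation. The truncated correlation
obeys a product recursion because it is the determinant of the two transfer vectors over the squared
partition function, and one transfer step has determinant `t (1 - u ^ 2)`. -/
theorem chain_eq (k : ℕ) :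
    (chain X w (1, w 0) k).2 = (chain X w (1, w 0) k).1 * endMagnet w k ∧
    (chain X w (w 0, 1) k).1 = (chain X w (1, w 0) k).1 * firstMagnet w k ∧
    (chain X w (w 0, 1) k).2 = (chain X w (1, w 0) k).1 * endCorr w k := by
  induction k with
  | zero => simp [chain, endMagnet, firstMagnet, endCorr, endTrunc]
  | succ k ih =>
    obtain ⟨h1, h2, h3⟩ := ih
    have hv := mul_stepInv w k
    simp only [chain, h1, h2, h3, endMagnet, firstMagnet, endCorr, endTrunc]
    change _ = _ * (_ * stepInv w k) ∧ _ ∧ _ = _ * (_ + _ * (_ * stepInv w k))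
    set z := (chain X w (1, w 0) k).1
    set m := endMagnet w k
    set v := stepInv w k
    set f := firstMagnet w k
    set g := endTrunc w k
    set a := w (k + 1)
    refine ⟨?_, ?_, ?_⟩
    · linear_combination (-z * (a + X * m)) * hv
    · linear_combination (-z * X * a * g) * hv
    · linear_combination (-z * (a * f + X * f * m) - z * X * g * ((1 + X * (a * m)) * v + 1)) * hv

theorem ringChain_eq (k : ℕ) :
    ringChain X w k = (chain X w (1, w 0) k).1 * (1 + X * endCorr w k) := by
  rw [ringChain, (chain_eq w k).2.2]; ring

theorem openLogDeriv_mul (k : ℕ) :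
    openLogDeriv w k * (chain X w (1, w 0) k).1 = derivative R (chain X w (1, w 0) k).1 := by
  induction k with
  | zero => simp [openLogDeriv, chain]
  | succ k ih =>
    have h : (chain X w (1, w 0) (k + 1)).1
        = (chain X w (1, w 0) k).1 * (1 + X * (w (k + 1) * endMagnet w k)) := by
      rw [chain, (chain_eq w k).1]; ring
    have hv := mul_stepInv w k
    rw [h, Derivation.leibniz, map_add, ← ih, openLogDeriv]
    simp only [smul_eq_mul, Derivation.map_one_eq_zero, zero_add]
    linear_combination ((chain X w (1, w 0) k).1 *
      derivative R (X * (w (k + 1) * endMagnet w k))) * hv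

theorem ringLogDeriv_mul (k : ℕ) :
    ringLogDeriv w k * ringChain X w k = derivative R (ringChain X w k) := by
  have hv := mul_geomInv (endCorr w k)
  rw [ringChain_eq, Derivation.leibniz, map_add, ← openLogDeriv_mul, ringLogDeriv]
  simp only [smul_eq_mul, Derivation.map_one_eq_zero, zero_add]
  linear_combination ((chain X w (1, w 0) k).1 * derivative R (X * endCorr w k)) * hv

theorem chain_constantCoeff (k : ℕ) :
    constantCoeff (chain X w (1, w 0) k).1 = 1 := by
  induction k with
  | zero => simp [chain]
  | succ k ih => simp [chain, ih]

theorem ringChain_constantCoeff (k : ℕ) : constantCoeff (ringChain X w k) = 1 := by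
  simp [ringChain, chain_constantCoeff]

theorem derivative_map {R' : Type*} [CommRing R'] (φ : R →+* R') (F : R⟦X⟧) :
    derivative R' (PowerSeries.map φ F) = PowerSeries.map φ (derivative R F) := by
  ext k
  simp [coeff_derivative]

end Series

/-! ### Norm bounds independent of the length of the chain. -/

section Bounds

variable {σ : Type*} {w : ℕ → (MvPolynomial σ ℝ)⟦X⟧}

/-- The bound `2` reproduces itself: it gives `4/3` for the inverse, since `1 + (1/8) * 2 * (4/3) =
4/3`, and then `(1 + 2/8) * (4/3) = 5/3 ≤ 2`. -/
theorem endMagnet_bound (hw : ∀ k, SeriesBound (1 / 8) 1 (w k)) (k : ℕ) :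
    SeriesBound (1 / 8) 2 (endMagnet w k) ∧ SeriesBound (1 / 8) (4 / 3) (stepInv w k) := by
  have hρ : (0 : ℝ) ≤ 1 / 8 := by norm_num
  have hstep (k : ℕ) (hm : SeriesBound (1 / 8) 2 (endMagnet w k)) :
      SeriesBound (1 / 8) (4 / 3) (stepInv w k) :=
    ((hw (k + 1)).mul hρ hm).geomInv hρ (by norm_num) (by norm_num)
  have hm (k : ℕ) : SeriesBound (1 / 8) 2 (endMagnet w k) := by
    induction k with
    | zero => exact (hw 0).mono (by norm_num)
    | succ k ih =>
      exact (((hw (k + 1)).add hρ (ih.X_mul hρ)).mul hρ (hstep k ih)).mono (by norm_num)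
  exact ⟨hm k, hstep k (hm k)⟩

/-- Each new site costs at most `(1/8) * 2 * (4/3) ^ 2 = 4/9 ≤ 1/2`. -/
theorem endTrunc_bound (hw : ∀ k, SeriesBound (1 / 8) 1 (w k)) (k : ℕ) :
    SeriesBound (1 / 8) (2 * (1 / 2) ^ k) (endTrunc w k) := by
  have hρ : (0 : ℝ) ≤ 1 / 8 := by norm_num
  have h1 (k : ℕ) : SeriesBound (1 / 8) 2 (1 - w k * w k) :=
    (SeriesBound.one.sub hρ ((hw k).mul hρ (hw k))).mono (by norm_num)
  induction k with
  | zero => exact (h1 0).mono (by norm_num)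
  | succ k ih =>
    have hv := (endMagnet_bound hw k).2
    refine ((ih.mul hρ ((h1 (k + 1)).mul hρ (hv.mul hρ hv))).X_mul hρ).mono ?_
    have : (0 : ℝ) ≤ (1 / 2) ^ k := by positivity
    rw [pow_succ]; linarith

/-- The increment at step `k` is at most `(1/3) * (1/2) ^ k`, exactly the growth of the stated
bound, so the geometric sum stays below `2`. -/
theorem firstMagnet_bound (hw : ∀ k, SeriesBound (1 / 8) 1 (w k)) (k : ℕ) :
    SeriesBound (1 / 8) (2 - 2 / 3 * (1 / 2) ^ k) (firstMagnet w k) := by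
  have hρ : (0 : ℝ) ≤ 1 / 8 := by norm_num
  induction k with
  | zero => exact (hw 0).mono (by norm_num)
  | succ k ih =>
    refine (ih.add hρ ((((hw (k + 1)).mul hρ (endMagnet_bound hw k).2).mul hρ
      (endTrunc_bound hw k)).X_mul hρ)).mono ?_
    rw [pow_succ]; linarith

theorem endCorr_bound (hw : ∀ k, SeriesBound (1 / 8) 1 (w k)) (k : ℕ) :
    SeriesBound (1 / 8) 6 (endCorr w k) ∧ SeriesBound (1 / 8) 4 (geomInv (endCorr w k)) := by
  have hρ : (0 : ℝ) ≤ 1 / 8 := by norm_num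
  have h : SeriesBound (1 / 8) 6 (endCorr w k) := by
    refine ((endTrunc_bound hw k).add hρ
      ((firstMagnet_bound hw k).mul hρ (endMagnet_bound hw k).1)).mono ?_
    have : ((1 : ℝ) / 2) ^ k ≤ 1 := pow_le_one₀ (by norm_num) (by norm_num)
    linarith
  exact ⟨h, h.geomInv hρ (by norm_num) (by norm_num)⟩

theorem openLogDeriv_step_bound (hw : ∀ k, SeriesBound (1 / 8) 1 (w k)) (k : ℕ) :
    SeriesBound (1 / 16) 3
      (derivative _ (X * (w (k + 1) * endMagnet w k)) * stepInv w k) := by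
  have hρ : (0 : ℝ) ≤ 1 / 8 := by norm_num
  have hρ' : (0 : ℝ) ≤ 1 / 16 := by norm_num
  have h1 := ((hw (k + 1)).mul hρ (endMagnet_bound hw k).1).derivative_X_mul hρ
  rw [show (1 / 8 : ℝ) / 2 = 1 / 16 by norm_num] at h1
  exact (h1.mul hρ' ((endMagnet_bound hw k).2.mono_radius hρ' (by norm_num))).mono (by norm_num)

theorem ringLogDeriv_last_bound (hw : ∀ k, SeriesBound (1 / 8) 1 (w k)) (k : ℕ) :
    SeriesBound (1 / 16) 24 (derivative _ (X * endCorr w k) * geomInv (endCorr w k)) := by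
  have hρ : (0 : ℝ) ≤ 1 / 8 := by norm_num
  have hρ' : (0 : ℝ) ≤ 1 / 16 := by norm_num
  have h1 := (endCorr_bound hw k).1.derivative_X_mul hρ
  rw [show (1 / 8 : ℝ) / 2 = 1 / 16 by norm_num] at h1
  exact (h1.mul hρ' ((endCorr_bound hw k).2.mono_radius hρ' (by norm_num))).mono (by norm_num)

theorem ringLogDeriv_bound (hw : ∀ k, SeriesBound (1 / 8) 1 (w k)) (k : ℕ) :
    SeriesBound (1 / 16) (3 * k + 24) (ringLogDeriv w k) := by
  have hρ' : (0 : ℝ) ≤ 1 / 16 := by norm_num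
  have h (k : ℕ) : SeriesBound (1 / 16) (3 * k) (openLogDeriv w k) := by
    induction k with
    | zero => simpa [openLogDeriv] using SeriesBound.zero
    | succ k ih =>
      refine (ih.add hρ' (openLogDeriv_step_bound hw k)).mono ?_
      push_cast; linarith
  exact (h k).add hρ' (ringLogDeriv_last_bound hw k)

end Bounds

end IsingChain

namespace IsingChain

open PowerSeries

/-! ### Locality, parity and rotation invariance of the logarithmic derivative. -/

section Sites

variable {n : ℕ}

/-- The field variables of the periodic chain with `n + 1` sites. -/
def siteField (n : ℕ) : ℕ → (MvPolynomial (Fin (n + 1)) ℝ)⟦X⟧ :=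
  periodic fun i => C (MvPolynomial.X i)

theorem siteField_bound (ρ : ℝ) (k : ℕ) : SeriesBound ρ 1 (siteField n k) := by
  rw [← coeffNorm_X (Fin.ofNat (n + 1) k)]
  exact SeriesBound.C _

theorem siteField_support {S : ℕ → Set (Fin (n + 1) →₀ ℕ)} {k : ℕ}
    (h : Finsupp.single (Fin.ofNat (n + 1) k) 1 ∈ S 0) : SeriesSupport S (siteField n k) :=
  SeriesSupport.C_X h

theorem eq_of_pos_single {i j : Fin (n + 1)} (h : 0 < Finsupp.single i 1 j) : i = j := by
  by_contra hij
  simp [hij] at h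

/-- Monomials supported on the sites `k - j, …, k`. -/
def lastSites (n k j : ℕ) : Set (Fin (n + 1) →₀ ℕ) :=
  {N | ∀ i, 0 < N i → k ≤ i.val + j ∧ i.val ≤ k}

/-- Monomials supported on the sites `0, …, min k j`. -/
def firstSites (n k j : ℕ) : Set (Fin (n + 1) →₀ ℕ) :=
  {N | ∀ i, 0 < N i → i.val ≤ j ∧ i.val ≤ k}

/-- Monomials supported on the first `a + 1` and the last `b + 1` sites with `a + b ≤ j`. -/
def endSites (n j : ℕ) : Set (Fin (n + 1) →₀ ℕ) :=
  {N | ∃ a b, a + b ≤ j ∧ ∀ i, 0 < N i → i.val ≤ a ∨ n ≤ i.val + b}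

theorem pos_or_pos {M M' : Fin (n + 1) →₀ ℕ} {i : Fin (n + 1)} (h : 0 < (M + M') i) :
    0 < M i ∨ 0 < M' i := by
  rw [Finsupp.add_apply] at h; omega

theorem lastSites_add {k i j : ℕ} {M M' : Fin (n + 1) →₀ ℕ} (h : M ∈ lastSites n k i)
    (h' : M' ∈ lastSites n k j) : M + M' ∈ lastSites n k (i + j) := fun s hs => by
  rcases pos_or_pos hs with h1 | h1
  · have := h s h1; omega
  · have := h' s h1; omega

theorem endSites_add {i j : ℕ} {M M' : Fin (n + 1) →₀ ℕ} (h : M ∈ endSites n i)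
    (h' : M' ∈ endSites n j) : M + M' ∈ endSites n (i + j) := by
  obtain ⟨a, b, hab, h⟩ := h
  obtain ⟨a', b', hab', h'⟩ := h'
  refine ⟨a + a', b + b', by omega, fun s hs => ?_⟩
  rcases pos_or_pos hs with h1 | h1
  · have := h s h1; omega
  · have := h' s h1; omega

theorem lastSites_subset_succ (k j : ℕ) : lastSites n k j ⊆ lastSites n (k + 1) (j + 1) :=
  fun _ h s hs => by have := h s hs; omega

theorem siteField_lastSites {k : ℕ} (hk : k ≤ n) :
    SeriesSupport (lastSites n k) (siteField n k) :=
  siteField_support fun i hi => by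
    have : i.val = k := by
      rw [← eq_of_pos_single hi, Fin.val_ofNat, Nat.mod_eq_of_lt (by omega)]
    omega

theorem zero_mem_lastSites (k : ℕ) : (0 : Fin (n + 1) →₀ ℕ) ∈ lastSites n k 0 :=
  fun i hi => by simp at hi

theorem X_mul_endMagnet_lastSites {k : ℕ} (hk : k + 1 ≤ n)
    (h : SeriesSupport (lastSites n k) (endMagnet (siteField n) k)) :
    SeriesSupport (lastSites n (k + 1))
      (X * (siteField n (k + 1) * endMagnet (siteField n) k)) := by
  rw [mul_left_comm]
  exact (siteField_lastSites hk).mul (h.X_mul (lastSites_subset_succ k))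
    fun i j M hM M' hM' => lastSites_add hM hM'

theorem stepInv_lastSites' {k : ℕ} (hk : k + 1 ≤ n)
    (h : SeriesSupport (lastSites n k) (endMagnet (siteField n) k)) :
    SeriesSupport (lastSites n (k + 1)) (stepInv (siteField n) k) :=
  SeriesSupport.geomInv (zero_mem_lastSites _) (fun _ _ _ hM _ hM' => lastSites_add hM hM')
    (X_mul_endMagnet_lastSites hk h)

theorem endMagnet_lastSites {k : ℕ} (hk : k ≤ n) :
    SeriesSupport (lastSites n k) (endMagnet (siteField n) k) := by
  induction k with
  | zero => exact siteField_lastSites hk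
  | succ k ih =>
    specialize ih (by omega)
    exact ((siteField_lastSites hk).add (ih.X_mul (lastSites_subset_succ k))).mul
      (stepInv_lastSites' hk ih) fun i j M hM M' hM' => lastSites_add hM hM'

theorem stepInv_lastSites {k : ℕ} (hk : k + 1 ≤ n) :
    SeriesSupport (lastSites n (k + 1)) (stepInv (siteField n) k) :=
  stepInv_lastSites' hk (endMagnet_lastSites (by omega))

/-- Monomials supported on the sites `0, …, k`. -/
def sitesUpTo (n k : ℕ) : Set (Fin (n + 1) →₀ ℕ) := {N | ∀ i, 0 < N i → i.val ≤ k}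

theorem sitesUpTo_add {k : ℕ} {M M' : Fin (n + 1) →₀ ℕ} (h : M ∈ sitesUpTo n k)
    (h' : M' ∈ sitesUpTo n k) : M + M' ∈ sitesUpTo n k := fun s hs => by
  rcases pos_or_pos hs with h1 | h1
  · exact h s h1
  · exact h' s h1

theorem lastSites_subset (k j : ℕ) : lastSites n k j ⊆ sitesUpTo n k := fun _ h s hs => (h s hs).2

theorem sitesUpTo_mono {k l : ℕ} (h : k ≤ l) : sitesUpTo n k ⊆ sitesUpTo n l :=
  fun _ hN s hs => (hN s hs).trans h

theorem SeriesSupport.mul_sitesUpTo {k : ℕ} {F G : (MvPolynomial (Fin (n + 1)) ℝ)⟦X⟧}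
    (hF : SeriesSupport (fun _ => sitesUpTo n k) F)
    (hG : SeriesSupport (fun _ => sitesUpTo n k) G) :
    SeriesSupport (fun _ => sitesUpTo n k) (F * G) :=
  hF.mul hG fun _ _ _ hM _ hM' => sitesUpTo_add hM hM'

theorem one_sub_sitesUpTo {k : ℕ} (hk : k ≤ n) : SeriesSupport (fun _ => sitesUpTo n k)
    (1 - siteField n k * siteField n k) := by
  have h := (siteField_lastSites hk).mono (lastSites_subset k)
  exact (SeriesSupport.one fun i hi => by simp at hi).sub (h.mul_sitesUpTo h)

/-- Correlating the two ends costs one power of `t` per bond. With `X ^ k` extracted, the cofactor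
may involve every site up to `k` without spoiling locality. -/
theorem endTrunc_eq {k : ℕ} (hk : k ≤ n) : ∃ G, endTrunc (siteField n) k = X ^ k * G ∧
    SeriesSupport (fun _ => sitesUpTo n k) G := by
  induction k with
  | zero => exact ⟨_, by rw [pow_zero, one_mul]; rfl, one_sub_sitesUpTo hk⟩
  | succ k ih =>
    obtain ⟨G, hG, hS⟩ := ih (by omega)
    have hv := (stepInv_lastSites hk).mono (lastSites_subset _)
    refine ⟨G * ((1 - siteField n (k + 1) * siteField n (k + 1)) *
      (stepInv (siteField n) k * stepInv (siteField n) k)), ?_, ?_⟩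
    · rw [endTrunc, hG]; ring
    · exact (hS.mono fun _ => sitesUpTo_mono (by omega)).mul_sitesUpTo
        ((one_sub_sitesUpTo hk).mul_sitesUpTo (hv.mul_sitesUpTo hv))

theorem firstMagnet_firstSites {k : ℕ} (hk : k ≤ n) :
    SeriesSupport (firstSites n k) (firstMagnet (siteField n) k) := by
  induction k with
  | zero =>
    refine (siteField_lastSites hk).mono fun j N hN i hi => ?_
    have := hN i hi
    omega
  | succ k ih =>
    obtain ⟨G, hG, hS⟩ := endTrunc_eq (n := n) (k := k) (by omega)
    have hv := (stepInv_lastSites hk).mono (lastSites_subset _)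
    have hw := (siteField_lastSites hk).mono (lastSites_subset _)
    have hsub : ∀ j, firstSites n k j ⊆ firstSites n (k + 1) j :=
      fun j N hN i hi => by have := hN i hi; omega
    refine ((ih (by omega)).mono hsub).add ?_
    · have : X * (siteField n (k + 1) * stepInv (siteField n) k * endTrunc (siteField n) k)
        = X ^ (k + 1) * (siteField n (k + 1) * stepInv (siteField n) k * G) := by
        rw [hG]; ring
      rw [this]
      refine ((hw.mul_sitesUpTo hv).mul_sitesUpTo
        (hS.mono fun _ => sitesUpTo_mono (by omega))).X_pow_mul _ fun j N hN i hi => ?_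
      have := hN i hi
      omega

theorem endCorr_endSites : SeriesSupport (endSites n) (endCorr (siteField n) n) := by
  obtain ⟨G, hG, hS⟩ := endTrunc_eq (le_refl n)
  refine SeriesSupport.add ?_ ?_
  · rw [hG]
    exact hS.X_pow_mul _ fun j N hN => ⟨j + n, 0, le_rfl, fun i hi => by have := hN i hi; omega⟩
  · refine (firstMagnet_firstSites le_rfl).mul (endMagnet_lastSites le_rfl)
      fun a b M hM M' hM' => ⟨a, b, le_rfl, fun i hi => ?_⟩
    rcases pos_or_pos hi with h | h
    · exact Or.inl (hM i h).1
    · exact Or.inr (hM' i h).1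

/-- Monomials supported on an interval of at most `r` sites of the periodic chain. -/
def inArc (n r : ℕ) : Set (Fin (n + 1) →₀ ℕ) := {N | ∃ c : Fin (n + 1), ∀ i, 0 < N i → i ∈ arc c r}

theorem mem_arc_of_le {c i : Fin (n + 1)} {r : ℕ} (h : n + 1 ≤ r) : i ∈ arc c r := by
  simp only [arc, Finset.mem_filter, Finset.mem_univ, true_and]
  omega

/-- The first `a + 1` and last `b + 1` sites are contiguous across the seam and form one arc of at
most `j + 2` sites. -/
theorem endSites_subset_inArc (j : ℕ) : endSites n j ⊆ inArc n (j + 2) := by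
  rintro N ⟨a, b, hab, h⟩
  rcases Nat.lt_or_ge (n - 1) j with hj | hj
  · exact ⟨0, fun i _ => mem_arc_of_le (by omega)⟩
  · refine ⟨⟨n - b, by omega⟩, fun i hi => ?_⟩
    simp only [arc, Finset.mem_filter, Finset.mem_univ, true_and, Fin.sub_def]
    rcases h i hi with h | h
    · have : (n + 1 - (n - b) + i.val) % (n + 1) ≤ n + 1 - (n - b) + i.val := Nat.mod_le _ _
      omega
    · rw [show n + 1 - (n - b) + i.val = (i.val - (n - b)) + (n + 1) by omega,
        Nat.add_mod_right]
      have : (i.val - (n - b)) % (n + 1) ≤ i.val - (n - b) := Nat.mod_le _ _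
      omega

theorem lastSites_subset_inArc (j : ℕ) : lastSites n n (j + 1) ⊆ inArc n (j + 2) := by
  intro N h
  rcases Nat.lt_or_ge (n - 1) j with hj | hj
  · exact ⟨0, fun i _ => mem_arc_of_le (by omega)⟩
  · refine ⟨⟨n - (j + 1), by omega⟩, fun i hi => ?_⟩
    simp only [arc, Finset.mem_filter, Finset.mem_univ, true_and, Fin.sub_def]
    have := h i hi
    rw [show n + 1 - (n - (j + 1)) + i.val = (i.val - (n - (j + 1))) + (n + 1) by omega,
        Nat.add_mod_right]
    have : (i.val - (n - (j + 1))) % (n + 1) ≤ i.val - (n - (j + 1)) := Nat.mod_le _ _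
    omega

theorem openLogDeriv_sitesUpTo {k : ℕ} (hk : k ≤ n) :
    SeriesSupport (fun _ => sitesUpTo n k) (openLogDeriv (siteField n) k) := by
  induction k with
  | zero => intro k N hN; simp [openLogDeriv] at hN
  | succ k ih =>
    refine ((ih (by omega)).mono fun _ => sitesUpTo_mono (by omega)).add ?_
    exact (((X_mul_endMagnet_lastSites hk (endMagnet_lastSites (by omega))).mono
      (lastSites_subset _)).derivative).mul_sitesUpTo
      ((stepInv_lastSites hk).mono (lastSites_subset _))

theorem ringLogDeriv_last_inArc : SeriesSupport (fun k => inArc n (k + 2))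
    (derivative _ (X * endCorr (siteField n) n) * geomInv (endCorr (siteField n) n)) := by
  have h1 : SeriesSupport (endSites n) (X * endCorr (siteField n) n) := by
    refine endCorr_endSites.X_mul fun j N ⟨a, b, hab, h⟩ => ⟨a, b, by omega, h⟩
  have h2 : SeriesSupport (endSites n) (derivative _ (X * endCorr (siteField n) n)) := by
    -- Order `k` of `X * endCorr` is supported as order `k - 1` of `endCorr`; recording this exact
    -- shift compensates the one caused by the derivative.
    have h3 : SeriesSupport (fun k => if k = 0 then ∅ else endSites n (k - 1))
        (X * endCorr (siteField n) n) := endCorr_endSites.X_mul fun j N h => by simpa using h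
    exact h3.derivative.mono fun k => by simp
  refine SeriesSupport.mono (S := endSites n) ?_ endSites_subset_inArc
  refine h2.mul (SeriesSupport.geomInv (S := endSites n)
    ⟨0, 0, le_rfl, fun i hi => by simp at hi⟩ (fun _ _ _ hM _ hM' => endSites_add hM hM') h1) fun _ _ _ hM _ hM' => endSites_add hM hM'

theorem openLogDeriv_step_inArc {k : ℕ} (hk : k + 1 = n) : SeriesSupport (fun k => inArc n (k + 2))
    (derivative _ (X * (siteField n (k + 1) * endMagnet (siteField n) k))
      * stepInv (siteField n) k) := by
  subst hk
  refine SeriesSupport.mono ?_ lastSites_subset_inArc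
  refine (X_mul_endMagnet_lastSites le_rfl (endMagnet_lastSites (by omega))).derivative.mul
    (stepInv_lastSites le_rfl) fun i j M hM M' hM' => ?_
  have := lastSites_add hM hM'
  rwa [show i + 1 + j = i + j + 1 by omega] at this

/-- The part of the logarithmic derivative that involves the last site has uniformly bounded
coefficients supported on short intervals. -/
theorem exists_anchored (n : ℕ) : ∃ G : (MvPolynomial (Fin (n + 1)) ℝ)⟦X⟧,
    SeriesBound (1 / 16) 27 G ∧ SeriesSupport (fun k => inArc n (k + 2)) G ∧
    ∀ k (N : Fin (n + 1) →₀ ℕ), 0 < N (Fin.last n) →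
      (coeff k (ringLogDeriv (siteField n) n)).coeff N = (coeff k G).coeff N := by
  have hρ : (0 : ℝ) ≤ 1 / 16 := by norm_num
  have hw : ∀ k, SeriesBound (1 / 8) 1 (siteField n k) := siteField_bound _
  have h2 := ringLogDeriv_last_inArc (n := n)
  have h3 := ringLogDeriv_last_bound hw n
  rcases Nat.eq_zero_or_pos n with rfl | hn
  · exact ⟨_, h3.mono (by norm_num), h2, fun k N _ => by simp [ringLogDeriv, openLogDeriv]⟩
  · obtain ⟨m, rfl⟩ : ∃ m, n = m + 1 := ⟨n - 1, by omega⟩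
    refine ⟨_, ((openLogDeriv_step_bound hw m).add hρ h3).mono (by norm_num),
      (openLogDeriv_step_inArc rfl).add h2, fun k N hN => ?_⟩
    -- The summands of the shorter open chain involve only sites up to `m`, hence never the last
    -- site.
    have h0 : (coeff k (openLogDeriv (siteField (m + 1)) m)).coeff N = 0 := by
      by_contra h
      have := openLogDeriv_sitesUpTo (Nat.le_succ m) k N h _ hN
      simp at this
    rw [ringLogDeriv, openLogDeriv]
    simp only [map_add, MvPolynomial.coeff_add, h0, zero_add]

/-- Parity is the spin-flip symmetry. A site variable must be paired with an endpoint of a used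
bond, so the degree is at most two per power of `t`, up to the offset due to inserted end spins. -/
theorem chain_support (k : ℕ) :
    SeriesSupport (fun j => {N : Fin (n + 1) →₀ ℕ | Even (degree N) ∧ degree N ≤ 2 * j})
      (chain X (siteField n) (1, siteField n 0) k).1 ∧
    SeriesSupport (fun j => {N : Fin (n + 1) →₀ ℕ | Odd (degree N) ∧ degree N ≤ 2 * j + 1})
      (chain X (siteField n) (1, siteField n 0) k).2 ∧
    SeriesSupport (fun j => {N : Fin (n + 1) →₀ ℕ | Odd (degree N) ∧ degree N ≤ 2 * j + 1})
      (chain X (siteField n) (siteField n 0, 1) k).1 ∧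
    SeriesSupport (fun j => {N : Fin (n + 1) →₀ ℕ | Even (degree N) ∧ degree N ≤ 2 * j + 2})
      (chain X (siteField n) (siteField n 0, 1) k).2 := by
  have hadd (M M' : Fin (n + 1) →₀ ℕ) : degree (M + M' : Fin (n + 1) →₀ ℕ)
      = degree M + degree M' := by simp [degree, Finset.sum_add_distrib]
  have hw (k : ℕ) : SeriesSupport
      (fun j => {N : Fin (n + 1) →₀ ℕ | Odd (degree N) ∧ degree N ≤ 2 * j + 1})
      (siteField n k) := siteField_support (by simp [degree, Finsupp.single_apply])
  have h1 : ∀ c, SeriesSupport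
      (fun j => {N : Fin (n + 1) →₀ ℕ | Even (degree N) ∧ degree N ≤ 2 * j + c})
      (1 : (MvPolynomial (Fin (n + 1)) ℝ)⟦X⟧) := fun c => SeriesSupport.one (by simp [degree])
  induction k with
  | zero => exact ⟨h1 0, hw 0, hw 0, h1 2⟩
  | succ k ih =>
    obtain ⟨hz, hy, hx, ht⟩ := ih
    simp only [chain]
    refine ⟨hz.add ?_, SeriesSupport.add ?_ ?_, hx.add ?_, SeriesSupport.add ?_ ?_⟩
    · rw [mul_assoc]
      refine ((hw (k + 1)).mul hy (T := fun j => {N | Even (degree N) ∧ degree N ≤ 2 * j + 2})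
        fun i j M hM M' hM' => ?_).X_mul fun j N hN => hN
      simp only [Set.mem_ofPred_eq, hadd] at *
      exact ⟨hM.1.add_odd hM'.1, by omega⟩
    · refine (hw (k + 1)).mul hz fun i j M hM M' hM' => ?_
      simp only [Set.mem_ofPred_eq, hadd] at *
      exact ⟨hM.1.add_even hM'.1, by omega⟩
    · exact hy.X_mul fun j N hN => ⟨hN.1, by have := hN.2; omega⟩
    · rw [mul_assoc]
      refine ((hw (k + 1)).mul ht (T := fun j => {N | Odd (degree N) ∧ degree N ≤ 2 * j + 3})
        fun i j M hM M' hM' => ?_).X_mul fun j N hN => hN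
      simp only [Set.mem_ofPred_eq, hadd] at *
      exact ⟨hM.1.add_even hM'.1, by omega⟩
    · refine (hw (k + 1)).mul hx fun i j M hM M' hM' => ?_
      simp only [Set.mem_ofPred_eq, hadd] at *
      exact ⟨hM.1.add_odd hM'.1, by omega⟩
    · exact ht.X_mul fun j N hN => ⟨hN.1, by have := hN.2; omega⟩

theorem ringChain_support : SeriesSupport
    (fun j => {N : Fin (n + 1) →₀ ℕ | Even (degree N) ∧ degree N ≤ 2 * j})
    (ringChain X (siteField n) n) :=
  (chain_support n).1.add ((chain_support n).2.2.2.X_mul fun _ _ h => h)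

theorem ringLogDeriv_support : SeriesSupport
    (fun j => {N : Fin (n + 1) →₀ ℕ | Even (degree N) ∧ degree N ≤ 2 * (j + 1)})
    (ringLogDeriv (siteField n) n) := by
  have hadd (M M' : Fin (n + 1) →₀ ℕ) : degree (M + M' : Fin (n + 1) →₀ ℕ)
      = degree M + degree M' := by simp [degree, Finset.sum_add_distrib]
  obtain ⟨H, hH⟩ : X ∣ ringChain X (siteField n) n - 1 := by
    rw [X_dvd_iff, map_sub, ringChain_constantCoeff]; simp
  have hP := ringLogDeriv_mul (siteField n) n
  have hD : ringLogDeriv (siteField n) n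
      = derivative _ (ringChain X (siteField n) n) * geomInv H := by
    rw [← hP, mul_assoc, show ringChain X (siteField n) n = 1 + X * H by rw [← hH]; ring,
      mul_geomInv, mul_one]
  have h0 : SeriesSupport
      (fun j => {N : Fin (n + 1) →₀ ℕ | Even (degree N) ∧ degree N ≤ 2 * j}) (X * H) := by
    rw [← hH]
    exact ringChain_support.sub (SeriesSupport.one (by simp [degree]))
  rw [hD]
  refine ringChain_support.derivative.mul (SeriesSupport.geomInv (by simp [degree]) ?_ h0) ?_
  · intro i j M hM M' hM'
    simp only [Set.mem_ofPred_eq, hadd] at *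
    exact ⟨hM.1.add hM'.1, by omega⟩
  · intro i j M hM M' hM'
    simp only [Set.mem_ofPred_eq, hadd] at *
    exact ⟨hM.1.add hM'.1, by omega⟩

/-- The series is determined by `D * P = P'` with `P ≠ 0` in a domain, so it inherits the rotation
invariance of `P`, although its definition as a sum over sites hides it. -/
theorem ringLogDeriv_rotate (a : Fin (n + 1)) :
    PowerSeries.map (MvPolynomial.rename (fun i => i + a)).toRingHom
      (ringLogDeriv (siteField n) n) = ringLogDeriv (siteField n) n := by
  set φ := PowerSeries.map
    (MvPolynomial.rename (R := ℝ) (fun i : Fin (n + 1) => i + a)).toRingHom with hφ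
  have hP : φ (ringChain X (siteField n) n) = ringChain X (siteField n) n := by
    rw [map_ringChain]
    have h1 : φ X = X := PowerSeries.map_X _
    have h2 : (fun k => φ (siteField n k))
        = periodic fun i : Fin (n + 1) => C (MvPolynomial.X (R := ℝ) (i + a)) := by
      funext k
      simp [hφ, siteField, periodic]
    rw [h1, h2]
    have h2 : (2 : (MvPolynomial (Fin (n + 1)) ℝ)⟦X⟧) ≠ 0 := fun h => by
      have h3 : ((MvPolynomial.eval (0 : Fin (n + 1) → ℝ)).comp constantCoeff)
        (2 : (MvPolynomial (Fin (n + 1)) ℝ)⟦X⟧) = 0 := by rw [h, map_zero]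
      rw [map_ofNat] at h3
      norm_num at h3
    exact ringChain_rotate h2 X (fun i => C (MvPolynomial.X i)) a
  have hne : ringChain X (siteField n) n ≠ 0 := fun h => by
    have := ringChain_constantCoeff (siteField n) n
    simp [h] at this
  refine mul_right_cancel₀ hne ?_
  rw [ringLogDeriv_mul]
  conv_lhs => rw [← hP]
  rw [← map_mul, ringLogDeriv_mul, hφ, ← derivative_map, ← hφ, hP]

theorem coeff_ringLogDeriv_rotate (a : Fin (n + 1)) (k : ℕ) (N : Fin (n + 1) →₀ ℕ) :
    (coeff k (ringLogDeriv (siteField n) n)).coeff (N.mapDomain fun i => i + a)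
      = (coeff k (ringLogDeriv (siteField n) n)).coeff N := by
  conv_lhs => rw [← ringLogDeriv_rotate a]
  rw [coeff_map]
  exact MvPolynomial.coeff_rename_mapDomain _ (add_left_injective a) _ _

end Sites

end IsingChain

namespace IsingChain

open PowerSeries

/-! ### From the formal logarithmic derivative to the real logarithm. -/

theorem hasSum_coeff_mul_pow (q : Polynomial ℝ) (s : ℝ) :
    HasSum (fun k => q.coeff k * s ^ k) (q.eval s) := by
  rw [Polynomial.eval_eq_sum_range]
  refine hasSum_sum_of_ne_finset_zero fun k hk => ?_
  rw [Polynomial.coeff_eq_zero_of_natDegree_lt (by simpa using hk), zero_mul]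

theorem tsum_mul_eval {F : ℝ⟦X⟧} {p q : Polynomial ℝ} (h : F * (p : ℝ⟦X⟧) = q) {s : ℝ}
    (hs : Summable fun k => ‖coeff k F * s ^ k‖) :
    (∑' k, coeff k F * s ^ k) * p.eval s = q.eval s := by
  have hp : Summable fun k => ‖p.coeff k * s ^ k‖ :=
    (hasSum_coeff_mul_pow p s).summable.norm
  rw [← (hasSum_coeff_mul_pow p s).tsum_eq,
    tsum_mul_tsum_eq_tsum_sum_antidiagonal_of_summable_norm hs hp,
    ← (hasSum_coeff_mul_pow q s).tsum_eq]
  refine tsum_congr fun k => ?_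
  rw [← Polynomial.coeff_coe, ← h, coeff_mul, Finset.sum_mul]
  refine Finset.sum_congr rfl fun x hx => ?_
  rw [← Finset.HasAntidiagonal.mem_antidiagonal.1 hx, Polynomial.coeff_coe, pow_add]
  ring

/-- A polynomial with constant term `1` is the exponential of the integral of its logarithmic
derivative. -/
theorem hasSum_log_of_logDeriv {F : ℝ⟦X⟧} {p : Polynomial ℝ}
    (h : F * (p : ℝ⟦X⟧) = Polynomial.derivative p) (h0 : p.eval 0 = 1) {B c : ℝ} (hc : 0 < c)
    (hF : ∀ k, |coeff k F| ≤ B * c ^ k) {s : ℝ} (hs : |s| * c < 1) :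
    0 < p.eval s ∧ HasSum (fun k => coeff k F * (s ^ (k + 1) / (k + 1))) (Real.log (p.eval s)) := by
  obtain ⟨r, hr1, hr2⟩ := exists_between ((lt_div_iff₀ hc).2 hs)
  have hr0 : 0 < r := (abs_nonneg s).trans_lt hr1
  have hrc : r * c < 1 := (lt_div_iff₀ hc).1 hr2
  have hB : 0 ≤ B := by simpa using (abs_nonneg _).trans (hF 0)
  have hsum : Summable fun k : ℕ => B * (r * c) ^ k :=
    (summable_geometric_of_lt_one (by positivity) hrc).mul_left B
  have hbound (k : ℕ) {y : ℝ} (hy : |y| ≤ r) : ‖coeff k F * y ^ k‖ ≤ B * (r * c) ^ k := by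
    rw [Real.norm_eq_abs, abs_mul, abs_pow, mul_pow]
    calc _ ≤ (B * c ^ k) * r ^ k := mul_le_mul (hF k) (pow_le_pow_left₀ (abs_nonneg _) hy _)
          (by positivity) (by positivity)
      _ = _ := by ring
  set ψ : ℝ → ℝ := fun y => ∑' k, coeff k F * (y ^ (k + 1) / (k + 1)) with hψ
  have hmem {y : ℝ} : y ∈ Set.Ioo (-r) r ↔ |y| < r := by rw [abs_lt]; rfl
  have hderiv {y : ℝ} (hy : y ∈ Set.Ioo (-r) r) :
      HasDerivAt ψ (∑' k, coeff k F * y ^ k) y := by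
    refine hasDerivAt_tsum_of_isPreconnected (𝕜 := ℝ) (F := ℝ)
      (g := fun k y => coeff k F * (y ^ (k + 1) / (k + 1))) (g' := fun k y => coeff k F * y ^ k)
      hsum isOpen_Ioo isPreconnected_Ioo ?_ ?_
      (hmem.2 (by simpa using hr0) : (0 : ℝ) ∈ Set.Ioo (-r) r) ?_ hy
    · intro k z _
      have h1 := (((hasDerivAt_pow (k + 1) z).div_const ((k : ℝ) + 1)).const_mul (coeff k F))
      have hk : (k : ℝ) + 1 ≠ 0 := by positivity
      refine h1.congr_deriv ?_
      rw [Nat.add_sub_cancel]; push_cast; field_simp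
    · exact fun k z hz => hbound k (hmem.1 hz).le
    · simp
  -- With `ψ` the integrated series, `p * exp (-ψ)` has zero derivative and equals `1` at `0`. So `p
  -- = exp ψ`, which also yields positivity of `p` instead of assuming it.
  have hconst {y : ℝ} (hy : y ∈ Set.Ioo (-r) r) :
      HasDerivAt (fun y => p.eval y * Real.exp (-ψ y)) 0 y := by
    refine ((p.hasDerivAt y).mul (hderiv hy).neg.exp).congr_deriv ?_
    rw [← tsum_mul_eval h (Summable.of_nonneg_of_le (fun _ => norm_nonneg _)
      (fun k => hbound k (hmem.1 hy).le) hsum)]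
    ring
  have hs' : s ∈ Set.Ioo (-r) r := hmem.2 hr1
  have heq := isOpen_Ioo.is_const_of_deriv_eq_zero isPreconnected_Ioo
    (fun y hy => (hconst hy).differentiableAt.differentiableWithinAt)
    (fun y hy => (hconst hy).deriv) hs' (hmem.2 (by simpa using hr0) : (0 : ℝ) ∈ Set.Ioo (-r) r)
  have hψ0 : ψ 0 = 0 := by simp [hψ]
  simp only [h0, hψ0, neg_zero, Real.exp_zero, mul_one] at heq
  have hp : p.eval s = Real.exp (ψ s) := by
    rw [Real.exp_neg] at heq
    have := Real.exp_ne_zero (ψ s)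
    field_simp at heq
    exact heq
  refine ⟨hp ▸ Real.exp_pos _, ?_⟩
  rw [hp, Real.log_exp]
  refine Summable.hasSum (Summable.of_norm_bounded (hsum.mul_left r) fun k => ?_)
  have h1 := hbound k hr1.le
  have hk : (1 : ℝ) ≤ k + 1 := by simp
  rw [pow_succ, mul_div_assoc, ← mul_assoc, norm_mul, mul_comm]
  refine mul_le_mul ?_ h1 (norm_nonneg _) hr0.le
  rw [norm_div, Real.norm_eq_abs, Real.norm_eq_abs, abs_of_pos (a := (k : ℝ) + 1) (by linarith)]
  exact (div_le_self (abs_nonneg _) hk).trans hr1.le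

/-- The coefficient of `t ^ k u ^ N` in the logarithmic derivative with respect to `t` of the
partition function of the periodic chain with `n + 1` sites. -/
def logDerivCoeff (n k : ℕ) (N : Fin (n + 1) → ℕ) : ℝ :=
  (coeff k (ringLogDeriv (siteField n) n)).coeff (Finsupp.equivFunOnFinite.symm N)

theorem hasSum_coeff_mul_monomial {n : ℕ} (p : MvPolynomial (Fin n) ℝ) (v : Fin n → ℝ) :
    HasSum (fun N : Fin n → ℕ => p.coeff (Finsupp.equivFunOnFinite.symm N) * monomial v N)
      (MvPolynomial.eval v p) := by
  rw [← Finsupp.equivFunOnFinite.hasSum_iff, MvPolynomial.eval_eq']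
  simp only [Function.comp_def, Equiv.symm_apply_apply]
  refine hasSum_sum_of_ne_finset_zero (s := p.support) fun N hN => ?_
  rw [MvPolynomial.notMem_support_iff.1 hN, zero_mul]

theorem hasSum_abs_coeff {n : ℕ} (p : MvPolynomial (Fin n) ℝ) :
    HasSum (fun N : Fin n → ℕ => |p.coeff (Finsupp.equivFunOnFinite.symm N)|) (coeffNorm p) := by
  rw [← Finsupp.equivFunOnFinite.hasSum_iff, coeffNorm]
  simp only [Function.comp_def, Equiv.symm_apply_apply]
  refine hasSum_sum_of_ne_finset_zero (s := p.support) fun N hN => ?_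
  rw [MvPolynomial.notMem_support_iff.1 hN, abs_zero]

theorem coeffNorm_ringLogDeriv_le (n k : ℕ) :
    coeffNorm (coeff k (ringLogDeriv (siteField n) n)) ≤ (3 * n + 24) * 16 ^ k := by
  have h := (ringLogDeriv_bound (siteField_bound (n := n) _) n).coeffNorm_coeff_le (by norm_num) k
  rwa [one_div, inv_pow, ← div_eq_mul_inv, div_le_iff₀ (by positivity)] at h

theorem hasSum_log_ringChain {n : ℕ} {v : Fin (n + 1) → ℝ} (hv : ∀ i, |v i| ≤ 1) {s : ℝ}
    (hs : |s| * 16 < 1) : 0 < ringChain s (periodic v) n ∧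
      HasSum (fun k => MvPolynomial.eval v (coeff k (ringLogDeriv (siteField n) n))
        * (s ^ (k + 1) / (k + 1))) (Real.log (ringChain s (periodic v) n)) := by
  set p : Polynomial ℝ := ringChain Polynomial.X (fun k => Polynomial.C (periodic v k)) n with hp
  have hev (y : ℝ) : p.eval y = ringChain y (periodic v) n := by
    rw [← Polynomial.coe_evalRingHom, hp, map_ringChain]; simp
  have hcoe : (p : ℝ⟦X⟧) = PowerSeries.map (MvPolynomial.eval v) (ringChain X (siteField n) n) := by
    rw [← Polynomial.coeToPowerSeries.ringHom_apply, hp, map_ringChain, map_ringChain]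
    simp [siteField, periodic]
  have hF : PowerSeries.map (MvPolynomial.eval v) (ringLogDeriv (siteField n) n) * (p : ℝ⟦X⟧)
      = Polynomial.derivative p := by
    rw [← derivative_coe, hcoe, derivative_map, ← map_mul, ringLogDeriv_mul]
  have h0 : p.eval 0 = 1 := by
    rw [← Polynomial.coeff_zero_eq_eval_zero, ← Polynomial.coeff_coe, hcoe, coeff_map,
      coeff_zero_eq_constantCoeff_apply, ringChain_constantCoeff, map_one]
  have := hasSum_log_of_logDeriv hF h0 (B := 3 * n + 24) (c := 16) (by norm_num) (fun k => by
    rw [coeff_map]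
    exact (abs_eval_le _ hv).trans (coeffNorm_ringLogDeriv_le n k)) hs
  simpa only [coeff_map, hev] using this

end IsingChain

namespace IsingChain

open PowerSeries

/-! ### The double expansion in `t` and `u`, and decay of its coefficients. -/

/-- The term of order `k + 1` in `t` of the coefficient of `u ^ N` in the logarithm of the
partition function. -/
def expansionTerm (n : ℕ) (t : ℝ) (k : ℕ) (N : Fin (n + 1) → ℕ) : ℝ :=
  logDerivCoeff n k N * (t ^ (k + 1) / (k + 1))

theorem abs_monomial_le {n : ℕ} {u : Fin n → ℝ} (hu : ∀ i, |u i| ≤ 1) (N : Fin n → ℕ) :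
    |monomial u N| ≤ 1 := by
  rw [monomial, Finset.abs_prod]
  refine Finset.prod_le_one (fun _ _ => abs_nonneg _) fun i _ => ?_
  rw [abs_pow]
  exact pow_le_one₀ (abs_nonneg _) (hu i)

section

variable {n : ℕ} {t : ℝ}

theorem abs_expansionTerm_le (ht : 0 ≤ t) (k : ℕ) (N : Fin (n + 1) → ℕ) :
    |expansionTerm n t k N| ≤ |logDerivCoeff n k N| * t ^ (k + 1) := by
  rw [expansionTerm, abs_mul, abs_of_nonneg (a := t ^ (k + 1) / ((k : ℝ) + 1)) (by positivity)]
  refine mul_le_mul_of_nonneg_left (div_le_self (by positivity) ?_) (abs_nonneg _)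
  simp

/-- The bound used grows linearly in the length of the chain, which is harmless: only summability
for fixed length is needed, to exchange the sums over `k` and `N`. -/
theorem summable_expansionTerm (ht : 0 ≤ t) (ht' : t * 16 < 1) :
    Summable fun x : ℕ × (Fin (n + 1) → ℕ) => |expansionTerm n t x.1 x.2| := by
  have hL (k : ℕ) : HasSum (fun N => |logDerivCoeff n k N| * t ^ (k + 1)) _ :=
    (hasSum_abs_coeff (coeff k (ringLogDeriv (siteField n) n))).mul_right (t ^ (k + 1))
  have hs (k : ℕ) : Summable fun N : Fin (n + 1) → ℕ => |expansionTerm n t k N| :=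
    (hL k).summable.of_nonneg_of_le (fun _ => abs_nonneg _) fun N => abs_expansionTerm_le ht k N
  refine (summable_prod_of_nonneg fun _ => abs_nonneg _).2 ⟨hs, ?_⟩
  refine Summable.of_nonneg_of_le (fun k => tsum_nonneg fun _ => abs_nonneg _) (fun k => ?_)
    ((summable_geometric_of_lt_one (r := t * 16) (by positivity) ht').mul_left ((3 * n + 24) * t))
  calc _ ≤ coeffNorm (coeff k (ringLogDeriv (siteField n) n)) * t ^ (k + 1) := by
        rw [← (hL k).tsum_eq]
        exact (hs k).tsum_le_tsum (fun N => abs_expansionTerm_le ht k N) (hL k).summable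
    _ ≤ ((3 * n + 24) * 16 ^ k) * t ^ (k + 1) :=
        mul_le_mul_of_nonneg_right (coeffNorm_ringLogDeriv_le n k) (by positivity)
    _ = _ := by rw [mul_pow, pow_succ]; ring

theorem summable_expansionTerm_order (ht : 0 ≤ t) (ht' : t * 16 < 1) (N : Fin (n + 1) → ℕ) :
    Summable fun k => |expansionTerm n t k N| :=
  (summable_expansionTerm ht ht').prod_symm.prod_factor N

theorem summable_tsum_expansionTerm (ht : 0 ≤ t) (ht' : t * 16 < 1) :
    Summable fun N : Fin (n + 1) → ℕ => |∑' k, expansionTerm n t k N| :=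
  (summable_expansionTerm ht ht').prod_symm.prod.of_nonneg_of_le (fun _ => abs_nonneg _)
    fun N => by
      simpa using norm_tsum_le_tsum_norm (f := fun k => expansionTerm n t k N)
        (summable_expansionTerm_order ht ht' N)

theorem hasSum_expansion (ht : 0 ≤ t) (ht' : t * 16 < 1) {u : Fin (n + 1) → ℝ}
    (hu : ∀ i, |u i| ≤ 1) :
    HasSum (fun N => (∑' k, expansionTerm n t k N) * monomial u N)
      (Real.log (ringChain t (periodic u) n)) := by
  have hf : Summable fun x : ℕ × (Fin (n + 1) → ℕ) =>
      expansionTerm n t x.1 x.2 * monomial u x.2 := by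
    refine Summable.of_norm_bounded (summable_expansionTerm ht ht') fun x => ?_
    rw [norm_mul, Real.norm_eq_abs, Real.norm_eq_abs]
    exact mul_le_of_le_one_right (abs_nonneg _) (abs_monomial_le hu _)
  have hlog := (hasSum_log_ringChain hu (s := t) (by rwa [abs_of_nonneg ht])).2
  have h1 := hf.hasSum.prod_fiberwise fun k => by
    have := (hasSum_coeff_mul_monomial (coeff k (ringLogDeriv (siteField n) n)) u).mul_right
      (t ^ (k + 1) / ((k : ℝ) + 1))
    refine this.congr_fun fun N => ?_
    simp only [expansionTerm, logDerivCoeff]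
    ring
  rw [hlog.unique h1]
  have h2 := ((Equiv.prodComm _ _).hasSum_iff.2 hf.hasSum).prod_fiberwise
    (g := fun N => (∑' k, expansionTerm n t k N) * monomial u N) fun N => by
    have := (summable_expansionTerm_order ht ht' N).of_abs.hasSum.mul_right (monomial u N)
    exact this
  exact h2

end

theorem arcLength_le {n r : ℕ} {N : Fin (n + 1) → ℕ} (c : Fin (n + 1))
    (h : ∀ i, 0 < N i → i ∈ arc c r) : arcLength N ≤ r := by
  have hcard : arcLength N ≤ (arc c r).card := Nat.sInf_le ⟨c, r, h, rfl⟩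
  refine hcard.trans ?_
  rw [← Finset.card_range r]
  refine Finset.card_le_card_of_injOn (fun i => (i - c).val) (fun i hi => ?_) fun i _ j _ hij => ?_
  · simpa [arc] using hi
  · simpa using Fin.val_injective hij

theorem logDerivCoeff_support {n k : ℕ} {N : Fin (n + 1) → ℕ} (h : logDerivCoeff n k N ≠ 0) :
    Even (degree N) ∧ degree N ≤ 2 * (k + 1) := by
  simpa using ringLogDeriv_support k _ h

/-- The terms of a given order that involve a given site. -/
theorem sum_abs_logDerivCoeff_le {n : ℕ} (i : Fin (n + 1)) {M : ℕ} (k : ℕ)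
    (F : Finset (Fin (n + 1) → ℕ)) (hF : ∀ N ∈ F, 0 < N i ∧ M ≤ size N) :
    ∑ N ∈ F, |logDerivCoeff n k N| ≤ if M ≤ 2 * (k + 1) then 27 * 16 ^ k else 0 := by
  classical
  obtain ⟨G, hG1, hG2, hG3⟩ := exists_anchored n
  -- The rotation by `a` moves site `i` to the last site, where the anchored bound applies.
  set a : Fin (n + 1) := Fin.last n - i with ha
  set τ : (Fin (n + 1) → ℕ) → (Fin (n + 1) →₀ ℕ) := fun N =>
    (Finsupp.equivFunOnFinite.symm N).mapDomain fun i => i + a with hτ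
  have hτa (N : Fin (n + 1) → ℕ) (j : Fin (n + 1)) : τ N (j + a) = N j := by
    rw [hτ]
    exact (Finsupp.mapDomain_apply (add_left_injective a) _ _).trans (by simp)
  have hcoeff (N : Fin (n + 1) → ℕ) (hN : 0 < N i) :
      logDerivCoeff n k N = (coeff k G).coeff (τ N) := by
    rw [← hG3 k (τ N), hτ, coeff_ringLogDeriv_rotate, logDerivCoeff]
    have := hτa N i
    rw [ha, add_sub_cancel] at this
    rwa [this]
  split_ifs with hM
  · have hinj : Set.InjOn τ F := fun N _ N' _ h => funext fun j => by
      rw [← hτa N j, ← hτa N' j, h]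
    calc _ = ∑ N ∈ F, |(coeff k G).coeff (τ N)| :=
          Finset.sum_congr rfl fun N hN => by rw [hcoeff N (hF N hN).1]
      _ = ∑ N ∈ F.image τ, |(coeff k G).coeff N| := 
          (Finset.sum_image (f := fun N => |(coeff k G).coeff N|) hinj).symm
      _ ≤ coeffNorm (coeff k G) := sum_abs_coeff_le _ _
      _ ≤ _ := by
        have := hG1.coeffNorm_coeff_le (by norm_num) k
        rwa [one_div, inv_pow, ← div_eq_mul_inv, div_le_iff₀ (by positivity)] at this
  · refine (Finset.sum_eq_zero fun N hN => ?_).le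
    rw [abs_eq_zero]
    by_contra h
    obtain ⟨hpos, hsize⟩ := hF N hN
    have hdeg := (logDerivCoeff_support h).2
    obtain ⟨c, hc⟩ := hG2 k (τ N) (hcoeff N hpos ▸ h)
    have harc : arcLength N ≤ k + 2 := arcLength_le (c - a) fun j hj => by
      have := hc (j + a) (by rwa [hτa])
      simp only [arc, Finset.mem_filter, Finset.mem_univ, true_and] at this ⊢
      rwa [show j - (c - a) = j + a - c by abel]
    rw [size] at hsize
    omega

/-- The exponent is `⌈M / 2⌉`, the least order in `t` at which a monomial of size `M` can occur. -/
theorem sum_tsum_expansionTerm_le {n : ℕ} {t : ℝ} (ht : 0 ≤ t) (ht' : 128 * t ≤ 1)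
    (i : Fin (n + 1)) {M : ℕ} (hM : 0 < M) (F : Finset (Fin (n + 1) → ℕ))
    (hF : ∀ N ∈ F, 0 < N i ∧ M ≤ size N) :
    ∑ N ∈ F, |∑' k, expansionTerm n t k N| ≤ (128 * t) ^ ((M - 1) / 2 + 1) := by
  have ht16 : t * 16 < 1 := by linarith
  have hs := fun N : Fin (n + 1) → ℕ => summable_expansionTerm_order ht ht16 N
  have hgeom : HasSum (fun k : ℕ => (128 * t) ^ ((M - 1) / 2 + 1) * ((1 / 2 : ℝ) / 2 ^ k))
      ((128 * t) ^ ((M - 1) / 2 + 1)) := by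
    have := (hasSum_geometric_two' (1 : ℝ)).mul_left ((128 * t) ^ ((M - 1) / 2 + 1))
    rwa [mul_one] at this
  calc _ ≤ ∑ N ∈ F, ∑' k, |expansionTerm n t k N| := Finset.sum_le_sum fun N _ => by
        simpa using norm_tsum_le_tsum_norm (f := fun k => expansionTerm n t k N) (hs N)
    _ = ∑' k, ∑ N ∈ F, |expansionTerm n t k N| := (Summable.tsum_finsetSum fun N _ => hs N).symm
    _ ≤ ∑' k : ℕ, (128 * t) ^ ((M - 1) / 2 + 1) * ((1 / 2 : ℝ) / 2 ^ k) := by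
        refine (summable_sum fun N _ => hs N).tsum_le_tsum (fun k => ?_) hgeom.summable
        have h1 : ∑ N ∈ F, |expansionTerm n t k N|
            ≤ (∑ N ∈ F, |logDerivCoeff n k N|) * t ^ (k + 1) := by
          rw [Finset.sum_mul]
          exact Finset.sum_le_sum fun N _ => abs_expansionTerm_le ht k N
        refine h1.trans ((mul_le_mul_of_nonneg_right (sum_abs_logDerivCoeff_le i k F hF)
          (by positivity)).trans ?_)
        split_ifs with hk
        -- Writing `64 = 128 / 2` leaves weights `2 ^ (-(k + 1))`, whose sum over all `k` is `1`.
        · calc 27 * 16 ^ k * t ^ (k + 1) ≤ 64 ^ (k + 1) * t ^ (k + 1) := by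
                refine mul_le_mul_of_nonneg_right ?_ (by positivity)
                rw [pow_succ, mul_comm]
                exact mul_le_mul (pow_le_pow_left₀ (by norm_num) (by norm_num) _) (by norm_num)
                  (by norm_num) (by positivity)
            _ = (128 * t) ^ (k + 1) * ((1 / 2 : ℝ) / 2 ^ k) := by
                rw [show (128 : ℝ) = 64 * 2 by norm_num, mul_pow, mul_pow, pow_succ 2 k]
                field_simp
            _ ≤ _ := by
                refine mul_le_mul_of_nonneg_right ?_ (by positivity)
                exact pow_le_pow_of_le_one (by positivity) ht' (by omega)
        · rw [zero_mul]; positivity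
    _ = _ := hgeom.tsum_eq

end IsingChain

namespace IsingChain

/-! ### The quadratic part. -/

open Filter Topology

section

variable {K : Type*} [CommRing K]

/-- The transfer iterations for a field `e * v`, up to third order in `e`. -/
theorem chain_scaled (t e : K) (v : ℕ → K) (k : ℕ) :
    (∃ r, (chain t (fun k => e * v k) (1, e * v 0) k).1 =
      1 + e ^ 2 * (∑ j ∈ Finset.range (k + 1), ∑ i ∈ Finset.range j, t ^ (j - i) * (v i * v j))
        + e ^ 3 * r) ∧
    (∃ r, (chain t (fun k => e * v k) (1, e * v 0) k).2 =
      e * (∑ i ∈ Finset.range (k + 1), t ^ (k - i) * v i) + e ^ 2 * r) ∧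
    (∃ r, (chain t (fun k => e * v k) (e * v 0, 1) k).1 =
      e * (∑ j ∈ Finset.range (k + 1), t ^ j * v j) + e ^ 2 * r) ∧
    (∃ r, (chain t (fun k => e * v k) (e * v 0, 1) k).2 = t ^ k
      + e ^ 2 * (∑ j ∈ Finset.range (k + 1), ∑ i ∈ Finset.range j,
        t ^ (k - (j - i)) * (v i * v j)) + e ^ 3 * r) := by
  induction k with
  | zero =>
    refine ⟨⟨0, ?_⟩, ⟨0, ?_⟩, ⟨0, ?_⟩, ⟨0, ?_⟩⟩ <;> simp [chain]
  | succ k ih =>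
    obtain ⟨⟨r1, h1⟩, ⟨r2, h2⟩, ⟨r3, h3⟩, ⟨r4, h4⟩⟩ := ih
    have hY : ∑ i ∈ Finset.range (k + 1), t ^ (k + 1 - i) * v i
        = t * ∑ i ∈ Finset.range (k + 1), t ^ (k - i) * v i := by
      rw [Finset.mul_sum]
      refine Finset.sum_congr rfl fun i hi => ?_
      rw [Nat.succ_sub (by simpa [Nat.lt_succ_iff] using hi), pow_succ]; ring
    have hZ : ∑ i ∈ Finset.range (k + 1), t ^ (k + 1 - i) * (v i * v (k + 1))
        = t * (∑ i ∈ Finset.range (k + 1), t ^ (k - i) * v i) * v (k + 1) := by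
      rw [← hY, Finset.sum_mul]
      exact Finset.sum_congr rfl fun i _ => by ring
    have hW : ∑ i ∈ Finset.range (k + 1), t ^ (k + 1 - (k + 1 - i)) * (v i * v (k + 1))
        = (∑ j ∈ Finset.range (k + 1), t ^ j * v j) * v (k + 1) := by
      rw [Finset.sum_mul]
      refine Finset.sum_congr rfl fun i hi => ?_
      rw [Nat.sub_sub_self (Finset.mem_range.1 hi).le]; ring
    have hW' : ∑ j ∈ Finset.range (k + 1), ∑ i ∈ Finset.range j,
          t ^ (k + 1 - (j - i)) * (v i * v j)
        = t * ∑ j ∈ Finset.range (k + 1), ∑ i ∈ Finset.range j,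
          t ^ (k - (j - i)) * (v i * v j) := by
      simp only [Finset.mul_sum]
      refine Finset.sum_congr rfl fun j hj => Finset.sum_congr rfl fun i _ => ?_
      have := Finset.mem_range.1 hj
      rw [show k + 1 - (j - i) = k - (j - i) + 1 by omega, pow_succ]; ring
    simp only [chain, h1, h2, h3, h4]
    refine ⟨⟨r1 + t * v (k + 1) * r2, ?_⟩, ⟨t * r2 + e * v (k + 1) *
      ((∑ j ∈ Finset.range (k + 1), ∑ i ∈ Finset.range j, t ^ (j - i) * (v i * v j))
        + e * r1), ?_⟩, ⟨r3 + t * e * v (k + 1) *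
      ((∑ j ∈ Finset.range (k + 1), ∑ i ∈ Finset.range j, t ^ (k - (j - i)) * (v i * v j))
        + e * r4), ?_⟩, ⟨v (k + 1) * r3 + t * r4, ?_⟩⟩
    · rw [Finset.sum_range_succ _ (k + 1), hZ]; ring
    · rw [Finset.sum_range_succ _ (k + 1), hY, Nat.sub_self]; ring
    · rw [Finset.sum_range_succ _ (k + 1)]; ring
    · rw [Finset.sum_range_succ _ (k + 1), hW, hW']; ring

theorem ringChain_scaled (t e : K) (v : ℕ → K) (n : ℕ) :
    ∃ r, ringChain t (fun k => e * v k) n = 1 + t ^ (n + 1)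
      + e ^ 2 * (∑ j ∈ Finset.range (n + 1), ∑ i ∈ Finset.range j,
        (t ^ (j - i) + t ^ (n + 1 - (j - i))) * (v i * v j)) + e ^ 3 * r := by
  obtain ⟨⟨r1, h1⟩, -, -, ⟨r4, h4⟩⟩ := chain_scaled t e v n
  refine ⟨r1 + t * r4, ?_⟩
  have h : ∑ j ∈ Finset.range (n + 1), ∑ i ∈ Finset.range j,
        (t ^ (j - i) + t ^ (n + 1 - (j - i))) * (v i * v j)
      = (∑ j ∈ Finset.range (n + 1), ∑ i ∈ Finset.range j, t ^ (j - i) * (v i * v j))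
        + t * ∑ j ∈ Finset.range (n + 1), ∑ i ∈ Finset.range j,
          t ^ (n - (j - i)) * (v i * v j) := by
    simp only [Finset.mul_sum, ← Finset.sum_add_distrib]
    refine Finset.sum_congr rfl fun j hj => Finset.sum_congr rfl fun i _ => ?_
    have := Finset.mem_range.1 hj
    rw [show n + 1 - (j - i) = n - (j - i) + 1 by omega, pow_succ]; ring
  rw [ringChain, h1, h4, h]; ring

end

/-- Expanding over the polynomial ring makes the remainder a polynomial in `x`, hence continuous at
`0`. -/
theorem exists_ringChain_expansion (t : ℝ) (v : ℕ → ℝ) (n : ℕ) :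
    ∃ ρ : Polynomial ℝ, ∀ x : ℝ, ringChain t (fun k => x * v k) n = 1 + t ^ (n + 1)
      + x ^ 2 * (∑ j ∈ Finset.range (n + 1), ∑ i ∈ Finset.range j,
        (t ^ (j - i) + t ^ (n + 1 - (j - i))) * (v i * v j)) + x ^ 3 * ρ.eval x := by
  obtain ⟨ρ, hρ⟩ := ringChain_scaled (Polynomial.C t) Polynomial.X (fun k => Polynomial.C (v k)) n
  refine ⟨ρ, fun x => ?_⟩
  have := congrArg (Polynomial.evalRingHom x) hρ
  rw [map_ringChain] at this
  simp_rw [mul_comm x (v _)]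
  simpa [Polynomial.eval_finsetSum] using this

/-- Both `s` and `q / κ` are limits of `(log (…) - log κ) / x ^ 2` at `0`: the first by the cubic
error bound, the second because `log` has derivative `1 / κ` at `κ`. -/
theorem eq_div_of_log_expansion {κ q s a C : ℝ} {ρ : ℝ → ℝ} (hκ : 0 < κ) (hρ : ContinuousAt ρ 0)
    (h : ∀ᶠ x in 𝓝 (0 : ℝ),
      |Real.log (κ + x ^ 2 * q + x ^ 3 * ρ x) - (a + x ^ 2 * s)| ≤ C * |x| ^ 3) :
    s = q / κ := by
  have ha : a = Real.log κ := by
    have := h.self_of_nhds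
    simp only [ne_eq, OfNat.ofNat_ne_zero, not_false_eq_true, zero_pow, zero_mul, add_zero, abs_zero,
      mul_zero] at this
    exact (sub_eq_zero.1 (abs_nonpos_iff.1 this)).symm
  have hlim1 : Tendsto (fun x : ℝ => (Real.log (κ + x ^ 2 * q + x ^ 3 * ρ x) - Real.log κ) / x ^ 2)
      (𝓝[≠] 0) (𝓝 s) := by
    rw [tendsto_iff_dist_tendsto_zero]
    have hC : Tendsto (fun x : ℝ => C * |x|) (𝓝[≠] 0) (𝓝 0) := by
      have : ContinuousAt (fun x : ℝ => C * |x|) 0 := by fun_prop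
      simpa using this.tendsto.mono_left nhdsWithin_le_nhds
    refine squeeze_zero' (Eventually.of_forall fun _ => dist_nonneg) ?_ hC
    filter_upwards [h.filter_mono nhdsWithin_le_nhds, self_mem_nhdsWithin] with x hx hx0
    have hx0 : x ≠ 0 := hx0
    have hx2 : 0 < x ^ 2 := by positivity
    rw [Real.dist_eq, div_sub' hx2.ne', abs_div, abs_of_pos hx2, div_le_iff₀ hx2]
    refine le_trans (le_of_eq ?_) (hx.trans_eq ?_)
    · rw [ha]; ring_nf
    · rw [← sq_abs x]; ring
  have hh : Tendsto (fun x : ℝ => κ + x ^ 2 * (q + x * ρ x)) (𝓝 0) (𝓝 κ) := by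
    have : ContinuousAt (fun x : ℝ => κ + x ^ 2 * (q + x * ρ x)) 0 := by fun_prop
    simpa [ContinuousAt] using this
  have hlim2 : Tendsto (fun x : ℝ => (Real.log (κ + x ^ 2 * q + x ^ 3 * ρ x) - Real.log κ) / x ^ 2)
      (𝓝[≠] 0) (𝓝 (q * κ⁻¹)) := by
    have hd : ContinuousAt (dslope Real.log κ) κ :=
      continuousAt_dslope_same.2 (Real.differentiableAt_log hκ.ne')
    have h1 : Tendsto (fun x : ℝ => (q + x * ρ x)
        * dslope Real.log κ (κ + x ^ 2 * (q + x * ρ x))) (𝓝 0) (𝓝 (q * κ⁻¹)) := by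
      have h2 : Tendsto (fun x : ℝ => q + x * ρ x) (𝓝 0) (𝓝 q) := by
        have : ContinuousAt (fun x : ℝ => q + x * ρ x) 0 := by fun_prop
        simpa [ContinuousAt] using this
      have h3 := hd.tendsto.comp hh
      rw [dslope_same, Real.deriv_log] at h3
      exact h2.mul h3
    refine (h1.mono_left nhdsWithin_le_nhds).congr' ?_
    filter_upwards [self_mem_nhdsWithin] with x hx0
    have hx0 : x ≠ 0 := hx0
    have := sub_smul_dslope Real.log κ (κ + x ^ 2 * (q + x * ρ x))
    rw [smul_eq_mul, add_sub_cancel_left] at this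
    rw [eq_div_iff (pow_ne_zero 2 hx0),
      show κ + x ^ 2 * q + x ^ 3 * ρ x = κ + x ^ 2 * (q + x * ρ x) by ring, ← this]
    ring
  exact tendsto_nhds_unique hlim1 hlim2

theorem monomial_scaled {n : ℕ} (x : ℝ) (v : Fin n → ℝ) (N : Fin n → ℕ) :
    monomial (fun i => x * v i) N = x ^ degree N * monomial v N := by
  simp only [monomial, degree, mul_pow, Finset.prod_mul_distrib, Finset.prod_pow_eq_pow_sum]

theorem abs_monomial_le_pow {n : ℕ} {v : Fin n → ℝ} {V : ℝ} (hv : ∀ i, |v i| ≤ V)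
    (N : Fin n → ℕ) : |monomial v N| ≤ V ^ degree N := by
  rw [monomial, degree, Finset.abs_prod, ← Finset.prod_pow_eq_pow_sum]
  refine Finset.prod_le_prod (fun _ _ => abs_nonneg _) fun i _ => ?_
  rw [abs_pow]
  exact pow_le_pow_left₀ (abs_nonneg _) (hv i) _

theorem degree_eq_zero {n : ℕ} {N : Fin n → ℕ} : degree N = 0 ↔ N = 0 := by
  simp [degree, funext_iff]

/-- An absolutely convergent even power series along a line, up to third order. -/
theorem abs_sub_quadratic_le {n : ℕ} {A : (Fin n → ℕ) → ℝ} (hA : Summable fun N => |A N|)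
    (hodd : ∀ N, Odd (degree N) → A N = 0) {v : Fin n → ℝ} {V : ℝ}
    (hv : ∀ i, |v i| ≤ V) {x : ℝ} (hx : |x| * V ≤ 1) (hV : 0 ≤ V) {y : ℝ}
    (hy : HasSum (fun N => A N * monomial (fun i => x * v i) N) y) :
    |y - (A 0 + x ^ 2 * ∑' N : {N : Fin n → ℕ // degree N = 2}, A N * monomial v N)|
      ≤ (∑' N, |A N| * V ^ 3) * |x| ^ 3 := by
  have h0 : HasSum (fun N : Fin n → ℕ => if N = 0 then A 0 else 0) (A 0) := hasSum_ite_eq _ _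
  have hs : Summable fun N : Fin n → ℕ => if degree N = 2 then A N * monomial v N else 0 := by
    refine Summable.of_norm_bounded (hA.mul_right (V ^ 2)) fun N => ?_
    split_ifs with h
    · rw [norm_mul, Real.norm_eq_abs, Real.norm_eq_abs, ← h]
      exact mul_le_mul_of_nonneg_left (abs_monomial_le_pow hv N) (abs_nonneg _)
    · rw [norm_zero]; positivity
  have h2 : HasSum (fun N : Fin n → ℕ => x ^ 2 * if degree N = 2 then A N * monomial v N else 0)
      (x ^ 2 * ∑' N : {N : Fin n → ℕ // degree N = 2}, A N * monomial v N) := by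
    have heq : ∑' N : {N : Fin n → ℕ // degree N = 2}, A N * monomial v N
        = ∑' N : Fin n → ℕ, if degree N = 2 then A N * monomial v N else 0 := by
      rw [← tsum_subtype_eq_of_support_subset (s := {N : Fin n → ℕ | degree N = 2})]
      · exact tsum_congr fun N => (if_pos N.2).symm
      · intro N hN
        by_contra h
        exact hN (if_neg h)
    rw [heq]
    exact hs.hasSum.mul_left (x ^ 2)
  have hd := hy.sub (h0.add h2)
  rw [← tsum_mul_right, ← Real.norm_eq_abs]
  refine hd.norm_le_of_bounded ((hA.mul_right (V ^ 3)).mul_right (|x| ^ 3)).hasSum fun N => ?_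
  rw [monomial_scaled]
  have hpos : 0 ≤ |A N| * V ^ 3 * |x| ^ 3 := by positivity
  by_cases hN0 : N = 0
  · subst hN0
    simpa [degree, monomial] using hpos
  have hdeg0 : degree N ≠ 0 := fun h => hN0 (degree_eq_zero.1 h)
  by_cases hN2 : degree N = 2
  · rw [if_neg hN0, if_pos hN2, hN2]
    convert hpos using 1
    rw [norm_eq_zero]; ring
  rw [if_neg hN0, if_neg hN2, mul_zero, add_zero, sub_zero, norm_mul, norm_mul, norm_pow]
  simp only [Real.norm_eq_abs]
  rcases Nat.lt_or_ge (degree N) 3 with h3 | h3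
  · rw [hodd N (by rw [show degree N = 1 by omega]; exact odd_one)]
    simp
  · calc |A N| * (|x| ^ degree N * |monomial v N|) ≤ |A N| * (|x| ^ degree N * V ^ degree N) := by
          gcongr; exact abs_monomial_le_pow hv N
      _ = |A N| * (|x| * V) ^ degree N := by rw [mul_pow]
      _ ≤ |A N| * (|x| * V) ^ 3 := by
          gcongr ?_ * ?_
          exact pow_le_pow_of_le_one (by positivity) hx h3
      _ = _ := by rw [mul_pow]; ring

theorem tsum_expansionTerm_odd {n : ℕ} (t : ℝ) {N : Fin (n + 1) → ℕ} (hN : Odd (degree N)) :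
    ∑' k, expansionTerm n t k N = 0 := by
  have (k : ℕ) : expansionTerm n t k N = 0 := by
    rw [expansionTerm]
    by_contra h
    exact Nat.not_even_iff_odd.2 hN (logDerivCoeff_support (left_ne_zero_of_mul h)).1
  simp [this]

theorem quadratic_part {n : ℕ} {t : ℝ} (ht : 0 ≤ t) (ht' : t * 16 < 1) (v : Fin (n + 1) → ℝ) :
    ∑' N : {N : Fin (n + 1) → ℕ // degree N = 2}, (∑' k, expansionTerm n t k N) * monomial v N
      = (∑ j ∈ Finset.range (n + 1), ∑ i ∈ Finset.range j,
        (t ^ (j - i) + t ^ (n + 1 - (j - i))) * (periodic v i * periodic v j))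
          / (1 + t ^ (n + 1)) := by
  obtain ⟨ρ, hρ⟩ := exists_ringChain_expansion t (periodic v) n
  set V : ℝ := 1 + ∑ i, |v i| with hV
  have hV1 : 1 ≤ V := by
    rw [hV, le_add_iff_nonneg_right]; exact Finset.sum_nonneg fun _ _ => abs_nonneg _
  have hv (i) : |v i| ≤ V :=
    (Finset.single_le_sum (f := fun i => |v i|) (fun _ _ => abs_nonneg _)
      (Finset.mem_univ i)).trans (by rw [hV]; linarith)
  refine eq_div_of_log_expansion (ρ := fun x => ρ.eval x) (a := ∑' k, expansionTerm n t k 0)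
    (C := ∑' N, |∑' k, expansionTerm n t k N| * V ^ 3) (by positivity) ρ.continuousAt ?_
  have hcont : ContinuousAt (fun x : ℝ => |x| * V) 0 := by fun_prop
  have hev : ∀ᶠ x in 𝓝 (0 : ℝ), |x| * V < 1 := hcont.tendsto.eventually_lt_const (by simp)
  filter_upwards [hev] with x hx
  rw [← hρ]
  have hxv (i) : |x * v i| ≤ 1 := by
    rw [abs_mul]
    exact (mul_le_mul_of_nonneg_left (hv i) (abs_nonneg _)).trans hx.le
  exact abs_sub_quadratic_le (summable_tsum_expansionTerm ht ht')
    (fun N hN => tsum_expansionTerm_odd t hN) hv hx.le (by linarith)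
    (hasSum_expansion ht ht' hxv)

/-- The coupling of two sites at distance `k` in the quadratic part. -/
def pairCoupling (ℓ : ℕ) (t : ℝ) (k : ℕ) : ℝ :=
  if 2 * k ≤ ℓ then (t ^ k + t ^ (ℓ - k)) / (1 + t ^ ℓ) else 0

/-- Two sites are joined by two arcs, of lengths `k` and `ℓ - k`; the coupling is symmetric in them
and so depends on the shorter one only. -/
theorem pairCoupling_ringDist {n : ℕ} (t : ℝ) {i j : Fin (n + 1)} (h : i < j) :
    pairCoupling (n + 1) t (ringDist i j)
      = (t ^ (j.val - i.val) + t ^ (n + 1 - (j.val - i.val))) / (1 + t ^ (n + 1)) := by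
  have h' : i.val < j.val := h
  have h1 : (j - i).val = j.val - i.val := Fin.sub_val_of_le h.le
  have h2 : (i - j).val = n + 1 - (j.val - i.val) := by
    rw [Fin.sub_def]
    simp only
    rw [Nat.mod_eq_of_lt (by omega)]
    omega
  rw [ringDist, h1, h2, pairCoupling]
  rcases le_total (j.val - i.val) (n + 1 - (j.val - i.val)) with h3 | h3
  · rw [min_eq_left h3, if_pos (by omega)]
  · rw [min_eq_right h3, if_pos (by omega), Nat.sub_sub_self (by omega), add_comm (t ^ _)]

theorem sum_pairCoupling {n : ℕ} (t : ℝ) (v : Fin (n + 1) → ℝ) :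
    ∑ i, ∑ j ∈ Finset.Ioi i, pairCoupling (n + 1) t (ringDist i j) * (v i * v j)
      = (∑ j ∈ Finset.range (n + 1), ∑ i ∈ Finset.range j,
        (t ^ (j - i) + t ^ (n + 1 - (j - i))) * (periodic v i * periodic v j))
          / (1 + t ^ (n + 1)) := by
  rw [Finset.sum_comm' (t' := Finset.univ) (s' := fun j => Finset.Iio j) (by simp),
    Finset.sum_range, Finset.sum_div]
  refine Finset.sum_congr rfl fun j _ => ?_
  rw [← Nat.Iio_eq_range, ← Fin.map_valEmbedding_Iio, Finset.sum_map, Finset.sum_div]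
  refine Finset.sum_congr rfl fun i hi => ?_
  rw [pairCoupling_ringDist t (Finset.mem_Iio.1 hi), Fin.valEmbedding_apply, periodic_val,
    periodic_val]
  ring

end IsingChain

namespace IsingChain

/-! ### Elementary estimates for `tanh`, the couplings and the decay rate. -/

theorem tanh_le_self {x : ℝ} (hx : 0 ≤ x) : Real.tanh x ≤ x := by
  have hd : Differentiable ℝ fun y : ℝ => y * Real.cosh y - Real.sinh y := by fun_prop
  have hm : MonotoneOn (fun y : ℝ => y * Real.cosh y - Real.sinh y) (Set.Ici 0) := by
    refine monotoneOn_of_deriv_nonneg (convex_Ici 0) hd.continuous.continuousOn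
      hd.differentiableOn fun y hy => ?_
    rw [interior_Ici, Set.mem_Ioi] at hy
    have h : HasDerivAt (fun y : ℝ => y * Real.cosh y - Real.sinh y)
        (1 * Real.cosh y + y * Real.sinh y - Real.cosh y) y :=
      ((hasDerivAt_id y).mul (Real.hasDerivAt_cosh y)).sub (Real.hasDerivAt_sinh y)
    rw [h.deriv, one_mul, add_sub_cancel_left]
    exact mul_nonneg hy.le (Real.sinh_nonneg_iff.2 hy.le)
  have h := hm (Set.mem_Ici.2 le_rfl) (Set.mem_Ici.2 hx) hx
  simp only [zero_mul, Real.sinh_zero, sub_zero, sub_nonneg] at h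
  rw [Real.tanh_eq_sinh_div_cosh, div_le_iff₀ (Real.cosh_pos x)]
  exact h

theorem le_tanh {x : ℝ} (hx : 0 ≤ x) : x * (1 - x ^ 2 / 2) ≤ Real.tanh x := by
  rw [Real.tanh_eq_sinh_div_cosh]
  calc x * (1 - x ^ 2 / 2) ≤ x * Real.exp (-(x ^ 2 / 2)) :=
        mul_le_mul_of_nonneg_left (by linarith [Real.add_one_le_exp (-(x ^ 2 / 2))]) hx
    _ = x / Real.exp (x ^ 2 / 2) := by rw [Real.exp_neg, ← div_eq_mul_inv]
    _ ≤ Real.sinh x / Real.cosh x := div_le_div₀ (Real.sinh_nonneg_iff.2 hx)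
        (Real.self_le_sinh_iff.2 hx) (Real.cosh_pos x) (Real.cosh_le_exp_half_sq x)

/-- The cutoff at `2 * k ≤ ℓ` is what makes this hold for all `k`: it ensures `t ^ (ℓ - k) ≤ t ^ k`,
and larger `k` are not distances on the ring. -/
theorem abs_pairCoupling_le {ℓ : ℕ} {t : ℝ} (ht : 0 ≤ t) (ht' : t ≤ 1) (k : ℕ) :
    |pairCoupling ℓ t k| ≤ 2 * t ^ k := by
  rw [pairCoupling]
  split_ifs with h
  · rw [abs_of_nonneg (by positivity), div_le_iff₀ (by positivity)]
    have h1 : t ^ (ℓ - k) ≤ t ^ k := pow_le_pow_of_le_one ht ht' (by omega)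
    have h2 : 0 ≤ t ^ k * t ^ ℓ := by positivity
    linarith
  · rw [abs_zero]; positivity

/-- For `ℓ ≥ 3` the long way round contributes only `t ^ (ℓ - 1) ≤ t ^ 2`; for `ℓ = 2` both ways
have length one and the leading term would double. -/
theorem abs_pairCoupling_one_sub_le {ℓ : ℕ} (hℓ : 3 ≤ ℓ) {x : ℝ} (hx : 0 ≤ x) (hx' : x ≤ 1) :
    |pairCoupling ℓ (Real.tanh x) 1 - x| ≤ 2 * x ^ 2 := by
  have h1 := tanh_le_self hx
  have h2 := le_tanh hx
  have ht : 0 ≤ Real.tanh x := le_trans (mul_nonneg hx (by nlinarith)) h2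
  set t := Real.tanh x
  have ht1 : t ≤ 1 := h1.trans hx'
  have h3 : t ^ (ℓ - 1) ≤ t ^ 2 := pow_le_pow_of_le_one ht ht1 (by omega)
  have h4 : t ^ ℓ ≤ t ^ 2 := pow_le_pow_of_le_one ht ht1 (by omega)
  have h5 : 0 ≤ t ^ (ℓ - 1) := by positivity
  have h6 : 0 ≤ t ^ ℓ := by positivity
  have h7 : t ^ 2 ≤ x ^ 2 := pow_le_pow_left₀ ht h1 2
  have h8 : x * x ^ 2 ≤ 1 * x ^ 2 := mul_le_mul_of_nonneg_right hx' (by positivity)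
  have hd : 0 < 1 + t ^ ℓ := by positivity
  rw [pairCoupling, if_pos (by omega), pow_one, abs_le]
  constructor
  · rw [le_sub_iff_add_le, le_div_iff₀ hd]
    nlinarith [mul_nonneg (show 0 ≤ 1 - x by linarith) h6]
  · rw [sub_le_iff_le_add, div_le_iff₀ hd]
    nlinarith [mul_nonneg hx h6, mul_nonneg (sq_nonneg x) h6]

/-- Here `exp (-2 b) = lam ^ (5/6)`, so the claim amounts to `lam ^ (1/6) ≤ 1/128`; this fixes the
threshold. -/
theorem decay_rate {lam b : ℝ} (h0 : 0 < lam) (h1 : lam < (1 / 128) ^ 6)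
    (hb : Real.exp b = lam ^ (-(5 / 12) : ℝ)) : 0 ≤ b ∧ 128 * lam ≤ Real.exp (-(2 * b)) := by
  have hlog : Real.log lam ≤ -6 * Real.log 128 := by
    have := Real.log_le_log h0 h1.le
    rw [Real.log_pow, one_div, Real.log_inv] at this
    push_cast at this
    linarith
  have h128 : 0 < Real.log 128 := Real.log_pos (by norm_num)
  have hb' : b = -(5 / 12) * Real.log lam := by
    rw [← Real.log_exp b, hb, Real.log_rpow h0]
  refine ⟨by rw [hb']; linarith, ?_⟩
  rw [← Real.log_le_iff_le_exp (by positivity), Real.log_mul (by norm_num) h0.ne', hb']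
  linarith

end IsingChain

/-! ### Assembly of the coefficients. -/

open IsingChain in
theorem mainTheorem6 :
    ∃ lam₀ : ℝ, 0 < lam₀ ∧ ∃ c : ℝ,
      ∀ lam b : ℝ, 0 < lam → lam < lam₀ → Real.exp b = lam ^ (-(5 / 12) : ℝ) →
      ∀ (ℓ : ℕ) [NeZero ℓ],
      ∃ A : (Fin ℓ → ℕ) → ℝ,
        -- absolute convergence (uniformly in `|u i| ≤ 1`) and the expansion
        Summable (fun N => |A N|) ∧
        (∀ h : Fin ℓ → ℝ,
          HasSum (fun N => A N * IsingChain.monomial (fun i => Real.tanh (h i)) N)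
            (Real.log (IsingChain.reducedPartitionFunction ℓ lam h))) ∧
        -- decay of the coefficients
        (∀ (i : Fin ℓ) (M : ℕ), 0 < M →
          ∑' N : {N : Fin ℓ → ℕ // 0 < N i ∧ M ≤ IsingChain.size N}, |A N|
            ≤ Real.exp (-(b * M))) ∧
        -- parity
        (∀ N : Fin ℓ → ℕ, Odd (IsingChain.degree N) → A N = 0) ∧
        -- the quadratic part
        ∃ α : ℕ → ℝ,
          (∀ u : Fin ℓ → ℝ,
            ∑' N : {N : Fin ℓ → ℕ // IsingChain.degree N = 2}, A N * IsingChain.monomial u N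
              = ∑ i, ∑ j ∈ Finset.Ioi i, α (IsingChain.ringDist i j) * (u i * u j)) ∧
          (3 ≤ ℓ → |α 1 - lam| ≤ c * lam * Real.exp (-(2 * b))) ∧
          (∀ k : ℕ, 0 < k → |α k| ≤ c * lam ^ k * Real.exp k) := by
  refine ⟨(1 / 128) ^ 6, by positivity, 2, fun lam b h0 h1 hb ℓ hℓ => ?_⟩
  obtain ⟨n, rfl⟩ : ∃ n, ℓ = n + 1 := ⟨ℓ - 1, by have := hℓ.out; omega⟩
  obtain ⟨hb0, hlam⟩ := decay_rate h0 h1 hb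
  have hexp1 : Real.exp (-(2 * b)) ≤ 1 := Real.exp_le_one_iff.2 (by linarith)
  have hlam1 : lam ≤ 1 := by linarith
  set t := Real.tanh lam with ht
  have htl : t ≤ lam := tanh_le_self h0.le
  have ht0 : 0 ≤ t := le_trans (mul_nonneg h0.le (by nlinarith)) (le_tanh h0.le)
  have ht16 : t * 16 < 1 := by linarith
  set a : (Fin (n + 1) → ℕ) → ℝ := fun N => ∑' k, expansionTerm n t k N with ha
  set κ : ℝ := Real.log (Real.cosh lam ^ (n + 1))
  -- The factor `cosh lam ^ ℓ` changes only the constant term, which enters none of the decay,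
  -- parity or quadratic claims.
  set A : (Fin (n + 1) → ℕ) → ℝ := fun N => (if N = 0 then κ else 0) + a N with hA
  have hAa {N : Fin (n + 1) → ℕ} (hN : N ≠ 0) : A N = a N := by simp [hA, hN]
  have hκ : HasSum (fun N : Fin (n + 1) → ℕ => if N = 0 then κ else 0) κ := hasSum_ite_eq _ _
  have hne {N : Fin (n + 1) → ℕ} (hN : degree N ≠ 0) : N ≠ 0 := fun h =>
    hN (degree_eq_zero.2 h)
  refine ⟨A, ?_, fun h => ?_, fun i M hM => ?_, fun N hN => ?_,
    pairCoupling (n + 1) t, fun u => ?_, fun h3 => ?_, fun k _ => ?_⟩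
  · exact (hκ.summable.add (summable_tsum_expansionTerm ht0 ht16).of_abs).abs
  · have hu (i) : |Real.tanh (h i)| ≤ 1 := (Real.abs_tanh_lt_one (h i)).le
    have hpos := (hasSum_log_ringChain hu (s := t) (by rwa [abs_of_nonneg ht0])).1
    rw [reducedPartitionFunction_eq, Real.log_mul (pow_pos (Real.cosh_pos _) _).ne' hpos.ne']
    refine (hκ.add (hasSum_expansion ht0 ht16 hu)).congr_fun fun N => ?_
    simp only [hA, add_mul]
    congr 1
    split_ifs with hN
    · simp [hN, monomial]
    · simp
  · have hpow : (128 * t) ^ ((M - 1) / 2 + 1) ≤ Real.exp (-(b * M)) := by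
      calc (128 * t) ^ ((M - 1) / 2 + 1) ≤ Real.exp (-(2 * b)) ^ ((M - 1) / 2 + 1) :=
            pow_le_pow_left₀ (by positivity) (by linarith) _
        _ = Real.exp (-(b * (2 * ((M - 1) / 2 + 1) : ℕ))) := by
            rw [← Real.exp_nat_mul]; push_cast; congr 1; ring
        _ ≤ Real.exp (-(b * M)) := by
            refine Real.exp_le_exp.2 (neg_le_neg (mul_le_mul_of_nonneg_left ?_ hb0))
            exact_mod_cast (by omega : M ≤ 2 * ((M - 1) / 2 + 1))
    refine le_trans (Real.tsum_le_of_sum_le (fun _ => abs_nonneg _) fun F => ?_) hpow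
    have h2 := sum_tsum_expansionTerm_le ht0 (by linarith) i hM
      (F.map (Function.Embedding.subtype _)) fun N hN => by
        obtain ⟨N, -, rfl⟩ := Finset.mem_map.1 hN
        exact N.2
    rw [Finset.sum_map] at h2
    refine le_trans (Finset.sum_le_sum fun N _ => ?_) h2
    rw [hAa]
    · rfl
    · intro h
      have := N.2.1
      simp [h] at this
  · rw [hAa (hne hN.pos.ne'), ha]
    exact tsum_expansionTerm_odd t hN
  · rw [sum_pairCoupling, ← quadratic_part ht0 ht16]
    refine tsum_congr fun N => ?_
    rw [hAa (hne (by rw [N.2]; norm_num))]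
  -- The error `2 * lam ^ 2` suffices because `lam ≤ 128 * lam ≤ exp (-(2 * b))`.
  · refine (abs_pairCoupling_one_sub_le h3 h0.le hlam1).trans ?_
    rw [mul_assoc, sq]
    gcongr
    linarith
  · refine (abs_pairCoupling_le ht0 (htl.trans hlam1) k).trans ?_
    rw [mul_assoc]
    refine mul_le_mul_of_nonneg_left ?_ (by norm_num)
    exact (pow_le_pow_left₀ ht0 htl k).trans
      (le_mul_of_one_le_right (by positivity) (Real.one_le_exp (by positivity)))

end
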